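/- Let $w(x)=1+|x|$ and $L^p_s(\mathbb R)=\{f: w^sf\in L^p(\mathbb R)\}$. Let $s>s_1>\tfrac12$ and let $u\in L^2_s(\mathbb R)$ be real-valued. For $k\in\mathbb C\setminus[0,\infty)$ put $G_k(x)=\frac1{2\pi}\int_0^\infty\frac{e^{ix\xi}}{\xi-k}\,d\xi$, and for $\lambda>0$ put $$G_{\lambda\pm0i}(x)=\pm i\,e^{i\lambda x}\chi_{\mathbb R^\pm}(x)-\frac1{2\pi}\int_{-\infty}^0\frac{e^{ix\xi}}{\xi-\lambda}\,d\xi$$ (for $x\neq0$; the integrals are improper, i.e. limits of integrals over bounded intervals). For $k\in(\mathbb C\setminus[0,\infty))\cup(\mathbb R^+\pm0i)$, where $\mathbb R^+=(0,\infty)$ and $\mathbb R^+\pm 0i$ denotes the two sides of the cut along $\mathbb R^+$, let $T_k\varphi=G_k*(u\varphi)$; in numerical expressions $k=\lambda\pm0i$ stands for $\lambda$. Let $C_+$ be the Cauchy projection on $L^2(\mathbb R)$, $\widehat{C_+f}=\chi_{\mathbb R^+}\hat f$, let $\mathbb H^+=C_+(L^2(\mathbb R))$ be the Hardy space of the upper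 half plane, and let $L_u=\frac1i\partial_x-C_+uC_+$, regarded as an unbounded operator on $\mathbb H^+$ with domain $\mathbb H^+\cap H^1(\mathbb R)$. Suppose that $\varphi\in L^\infty_{-(s-s_1)}(\mathbb R)$ satisfies $\varphi=T_k\varphi$ (almost everywhere) for some $k\in(\mathbb C\setminus[0,\infty))\cup(\mathbb R^+\pm0i)$. Then: 1. If $k\in\mathbb C\setminus\mathbb R$, then $\varphi=0$. 2. If $k\in(-\infty,0)\cup(\mathbb R^+\pm0i)$, then $u\varphi\in L^1(\mathbb R)$, $\varphi\in L^2(\mathbb R)$ and $$\Big|\int_{\mathbb R}u\varphi\,dx\Big|^2=-2\pi k\int_{\mathbb R}|\varphi|^2\,dx .$$ In particular, $\varphi=0$ if $k\in\mathbb R^+\pm0i$, or if $k$ is in the resolvent set of $L_u$. Moreover, $L_u$ has no eigenvalue in $(0,\infty)$, i.e. no positive eigenvalue embedded in its essential spectrum. -/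

import Mathlib

open MeasureTheory Filter Topology
open scoped FourierTransform ENNReal

noncomputable section

namespace BenjaminOno

/-- `f ∈ L^p_s(ℝ)`, i.e. `w^s f ∈ L^p(ℝ)` with the weight `w(x) = 1 + |x|`. -/
def MemWeightedLp {E : Type*} [NormedAddCommGroup E] [NormedSpace ℝ E]
    (f : ℝ → E) (p : ℝ≥0∞) (s : ℝ) : Prop :=
  MemLp (fun x : ℝ => ((1 + |x|) ^ s : ℝ) • f x) p volume

/-- The set `(ℂ ∖ [0,∞)) ∪ (ℝ⁺ ± 0i)`: the plane cut along `[0,∞)`, together with the two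
sides of the open half line `ℝ⁺ = (0,∞)`. -/
inductive CutPlane : Type
  | off (k : ℂ) (hk : k ∉ ((↑) : ℝ → ℂ) '' Set.Ici 0) : CutPlane
  | above (l : ℝ) (hl : 0 < l) : CutPlane
  | below (l : ℝ) (hl : 0 < l) : CutPlane

/-- The complex number underlying a point of the cut plane (`λ ± 0i` lies over `λ`). -/
def CutPlane.val : CutPlane → ℂ
  | .off k _ => k
  | .above l _ => (l : ℂ)
  | .below l _ => (l : ℂ)

/-- `(2π)⁻¹ ∫_0^∞ e^{ixξ} / (ξ - k) dξ`. The integral converges only conditionally (for `x ≠ 0`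
and `k ∉ [0,∞)`), and is the limit of the integrals over `[0, R]` as `R → ∞`. -/
def kernelPos (k : ℂ) (x : ℝ) : ℂ :=
  limUnder atTop fun R : ℝ =>
    (1 / (2 * (Real.pi : ℂ))) *
      ∫ ξ in (0 : ℝ)..R, Complex.exp (Complex.I * (x : ℂ) * (ξ : ℂ)) / ((ξ : ℂ) - k)

/-- `(2π)⁻¹ ∫_{-∞}^0 e^{ixξ} / (ξ - k) dξ`, converging conditionally for `x ≠ 0` and
`k ∉ (-∞,0]`. -/
def kernelNeg (k : ℂ) (x : ℝ) : ℂ :=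
  limUnder atTop fun R : ℝ =>
    (1 / (2 * (Real.pi : ℂ))) *
      ∫ ξ in (-R)..(0 : ℝ), Complex.exp (Complex.I * (x : ℂ) * (ξ : ℂ)) / ((ξ : ℂ) - k)

/-- The convolution kernel `G_k`; on the cut,
`G_{λ ± 0i}(x) = ± i e^{iλx} χ_{ℝ^±}(x) - (2π)⁻¹ ∫_{-∞}^0 e^{ixξ} / (ξ - λ) dξ`. -/
def kernelG : CutPlane → ℝ → ℂ
  | .off k _ => kernelPos k
  | .above l _ => fun x =>
      (Set.Ioi (0 : ℝ)).indicator
        (fun x : ℝ => Complex.I * Complex.exp (Complex.I * (l : ℂ) * (x : ℂ))) x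
        - kernelNeg (l : ℂ) x
  | .below l _ => fun x =>
      (Set.Iio (0 : ℝ)).indicator
        (fun x : ℝ => -(Complex.I * Complex.exp (Complex.I * (l : ℂ) * (x : ℂ)))) x
        - kernelNeg (l : ℂ) x

/-- `T_k φ = G_k * (u φ)`. -/
def opT (u : ℝ → ℝ) (k : CutPlane) (φ : ℝ → ℂ) (x : ℝ) : ℂ :=
  ∫ y : ℝ, kernelG k (x - y) * ((u y : ℂ) * φ y)

/-- The Hilbert space `L²(ℝ; ℂ)`. -/
abbrev L2 : Type := Lp ℂ 2 (volume : Measure ℝ)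

/-- Multiplication by the function `m` in `L²(ℝ)`, with its natural domain
`{f ∈ L² : m f ∈ L²}`. -/
def mulOp (m : ℝ → ℂ) : L2 →ₗ.[ℂ] L2 where
  domain :=
    { carrier := {f | MemLp (fun x => m x * f x) 2 volume}
      add_mem' := by
        intro f g hf hg
        refine (MemLp.add hf hg).ae_eq ?_
        filter_upwards [Lp.coeFn_add f g] with x hx
        simp only [Pi.add_apply, hx, mul_add]
      zero_mem' := by
        refine (MemLp.zero (p := 2) (μ := volume) : MemLp (fun _ : ℝ => (0 : ℂ)) 2 volume).ae_eq ?_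
        filter_upwards [Lp.coeFn_zero ℂ 2 (volume : Measure ℝ)] with x hx
        simp only [hx, Pi.zero_apply, mul_zero]
      smul_mem' := by
        intro c f hf
        refine (MemLp.const_smul hf c).ae_eq ?_
        filter_upwards [Lp.coeFn_smul c f] with x hx
        simp only [Pi.smul_apply, hx, smul_eq_mul]
        ring }
  toFun :=
    { toFun := fun f => MemLp.toLp (fun x => m x * (f : L2) x) f.2
      map_add' := by
        intro f g
        rw [← MemLp.toLp_add]
        apply MemLp.toLp_congr
        filter_upwards [Lp.coeFn_add (f : L2) (g : L2)] with x hx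
        simp only [Submodule.coe_add, Pi.add_apply, hx, mul_add]
      map_smul' := by
        intro c f
        rw [RingHom.id_apply, ← MemLp.toLp_const_smul]
        apply MemLp.toLp_congr
        filter_upwards [Lp.coeFn_smul c (f : L2)] with x hx
        simp only [Submodule.coe_smul, Pi.smul_apply, hx, smul_eq_mul]
        ring }

theorem coeFn_mulOp (m : ℝ → ℂ) (f : (mulOp m).domain) :
    (mulOp m f : ℝ → ℂ) =ᵐ[volume] fun x => m x * (f : L2) x :=
  MemLp.coeFn_toLp f.2

/-- The Fourier multiplier operator `f ↦ F⁻¹ (m · F f)` in `L²(ℝ)` with its natural domain.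
Here `F` is Mathlib's unitary Fourier transform, with phase `e^{-2πixξ}`. -/
def fourierMul (m : ℝ → ℂ) : L2 →ₗ.[ℂ] L2 where
  domain := (mulOp m).domain.comap (Lp.fourierTransformₗᵢ ℝ ℂ).toLinearEquiv.toLinearMap
  toFun :=
    { toFun := fun f => 𝓕⁻ (mulOp m ⟨𝓕 (f : L2), f.2⟩)
      map_add' := by
        intro f g
        have h : mulOp m ⟨𝓕 ((f + g : _) : L2), (f + g).2⟩ =
            mulOp m ⟨𝓕 (f : L2), f.2⟩ + mulOp m ⟨𝓕 (g : L2), g.2⟩ := by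
          rw [← LinearPMap.map_add]
          congr 1
          ext1
          exact (Lp.fourierTransformₗᵢ ℝ ℂ).map_add (f : L2) (g : L2)
        rw [h]
        exact (Lp.fourierTransformₗᵢ ℝ ℂ).symm.map_add _ _
      map_smul' := by
        intro c f
        have h : mulOp m ⟨𝓕 ((c • f : _) : L2), (c • f).2⟩ =
            c • mulOp m ⟨𝓕 (f : L2), f.2⟩ := by
          rw [← LinearPMap.map_smul]
          congr 1
          ext1
          exact (Lp.fourierTransformₗᵢ ℝ ℂ).map_smul c (f : L2)
        rw [h]
        exact (Lp.fourierTransformₗᵢ ℝ ℂ).symm.map_smul _ _ }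

/-- The symbol `χ_{ℝ⁺}` of the Cauchy projection. -/
def chiPos : ℝ → ℂ := (Set.Ioi (0 : ℝ)).indicator fun _ => 1

theorem mem_mulOp_chiPos (f : L2) : f ∈ (mulOp chiPos).domain := by
  change MemLp (fun x => chiPos x * f x) 2 volume
  refine ((Lp.memLp f).indicator (measurableSet_Ioi (a := (0 : ℝ)))).ae_eq (ae_of_all _ ?_)
  intro x
  by_cases hx : 0 < x <;> simp [chiPos, hx]

/-- The Cauchy projection `C₊` on `L²(ℝ)`: the Fourier transform of `C₊ f` is
`χ_{ℝ⁺}` times that of `f`. -/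
def cauchyPlus : L2 →ₗ[ℂ] L2 :=
  (fourierMul chiPos).toFun.comp
    (LinearMap.id.codRestrict _ fun f => mem_mulOp_chiPos (𝓕 f))

/-- The Hardy space `H⁺ = C₊(L²(ℝ))` of the upper half plane, a subspace of `L²(ℝ)`. -/
def hardy : Submodule ℂ L2 := LinearMap.range cauchyPlus

/-- The operator `(1/i) ∂_x` in `L²(ℝ)`, with domain the Sobolev space `H¹(ℝ)`. On the Fourier
side, with phase `e^{-2πixξ}`, it is multiplication by `2πξ`. -/
def momentum : L2 →ₗ.[ℂ] L2 := fourierMul fun ξ => ((2 * Real.pi * ξ : ℝ) : ℂ)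

theorem fourier_cauchyPlus (f : L2) :
    (𝓕 (cauchyPlus f) : L2) =ᵐ[volume] fun ξ => chiPos ξ * (𝓕 f : L2) ξ := by
  have h : 𝓕 (cauchyPlus f) = mulOp chiPos ⟨𝓕 f, mem_mulOp_chiPos (𝓕 f)⟩ :=
    FourierTransform.fourier_fourierInv_eq _
  rw [h]
  exact coeFn_mulOp _ _

theorem fourier_fourierMul (m : ℝ → ℂ) (f : (fourierMul m).domain) :
    (𝓕 (fourierMul m f) : L2) =ᵐ[volume] fun ξ => m ξ * (𝓕 (f : L2) : L2) ξ := by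
  have h : 𝓕 (fourierMul m f) = mulOp m ⟨𝓕 (f : L2), f.2⟩ :=
    FourierTransform.fourier_fourierInv_eq _
  rw [h]
  exact coeFn_mulOp _ _

theorem momentum_mem_hardy (f : momentum.domain) (hf : (f : L2) ∈ hardy) :
    momentum f ∈ hardy := by
  obtain ⟨g, hg⟩ := hf
  refine ⟨momentum f, ?_⟩
  apply (Lp.fourierTransformₗᵢ ℝ ℂ).injective
  change 𝓕 (cauchyPlus (momentum f)) = 𝓕 (momentum f)
  apply Lp.ext
  have h1 := fourier_cauchyPlus (momentum f)
  have h2 : (𝓕 (momentum f) : L2) =ᵐ[volume] _ := fourier_fourierMul _ f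
  have h3 := fourier_cauchyPlus g
  rw [hg] at h3
  filter_upwards [h1, h2, h3] with ξ e1 e2 e3
  rw [e1, e2, e3]
  by_cases hx : 0 < ξ <;> simp [chiPos, hx]

/-- The operator `L_u φ = (1/i) ∂_x φ - C₊(u C₊ φ)` on the Hardy space `H⁺`, with its natural
domain `{φ ∈ H⁺ ∩ H¹(ℝ) : u C₊ φ ∈ L²(ℝ)}`. (For `u ∈ L²(ℝ)` the last condition is automatic,
and the domain is `H⁺ ∩ H¹(ℝ)`.) -/
def opL (u : ℝ → ℝ) : hardy →ₗ.[ℂ] hardy where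
  domain := (momentum.domain.comap hardy.subtype) ⊓
    (((mulOp fun x => (u x : ℂ)).domain.comap cauchyPlus).comap hardy.subtype)
  toFun :=
    { toFun := fun φ =>
        ⟨momentum ⟨((φ : hardy) : L2), φ.2.1⟩, momentum_mem_hardy _ (φ : hardy).2⟩ -
        ⟨cauchyPlus (mulOp (fun x => (u x : ℂ)) ⟨cauchyPlus ((φ : hardy) : L2), φ.2.2⟩),
          LinearMap.mem_range_self _ _⟩
      map_add' := by
        intro φ ψ
        ext1
        have h1 : momentum ⟨((φ + ψ : _) : L2), (φ + ψ).2.1⟩ =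
            momentum ⟨((φ : hardy) : L2), φ.2.1⟩ + momentum ⟨((ψ : hardy) : L2), ψ.2.1⟩ :=
          momentum.map_add ⟨((φ : hardy) : L2), φ.2.1⟩ ⟨((ψ : hardy) : L2), ψ.2.1⟩
        have h2 : mulOp (fun x => (u x : ℂ)) ⟨cauchyPlus ((φ + ψ : _) : L2), (φ + ψ).2.2⟩ =
            mulOp (fun x => (u x : ℂ)) ⟨cauchyPlus ((φ : hardy) : L2), φ.2.2⟩ +
            mulOp (fun x => (u x : ℂ)) ⟨cauchyPlus ((ψ : hardy) : L2), ψ.2.2⟩ := by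
          rw [← LinearPMap.map_add]
          congr 1
          ext1
          exact map_add cauchyPlus _ _
        simp only [Submodule.coe_add, Submodule.coe_sub] at h1 h2 ⊢
        rw [h1, h2, map_add]
        abel
      map_smul' := by
        intro c φ
        ext1
        have h1 : momentum ⟨((c • φ : _) : L2), (c • φ).2.1⟩ =
            c • momentum ⟨((φ : hardy) : L2), φ.2.1⟩ :=
          momentum.map_smul c ⟨((φ : hardy) : L2), φ.2.1⟩
        have h2 : mulOp (fun x => (u x : ℂ)) ⟨cauchyPlus ((c • φ : _) : L2), (c • φ).2.2⟩ =
            c • mulOp (fun x => (u x : ℂ)) ⟨cauchyPlus ((φ : hardy) : L2), φ.2.2⟩ := by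
          rw [← LinearPMap.map_smul]
          congr 1
          ext1
          exact map_smul cauchyPlus _ _
        simp only [Submodule.coe_smul, Submodule.coe_sub, RingHom.id_apply] at h1 h2 ⊢
        rw [h1, h2, map_smul, smul_sub] }

/-- The resolvent set of an unbounded operator `A`: the `k` for which `A - k` maps the domain
of `A` bijectively onto the whole space with a bounded inverse `R`. -/
def resolventSet {E : Type*} [NormedAddCommGroup E] [NormedSpace ℂ E] (A : E →ₗ.[ℂ] E) : Set ℂ :=
  {k | ∃ R : E →L[ℂ] E,
    (∀ f : E, ∃ h : R f ∈ A.domain, A ⟨R f, h⟩ - k • R f = f) ∧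
    ∀ φ : A.domain, R (A φ - k • (φ : E)) = φ}

/-- `k` is an eigenvalue of the unbounded operator `A`. -/
def IsEigenvalue {E : Type*} [NormedAddCommGroup E] [NormedSpace ℂ E] (A : E →ₗ.[ℂ] E)
    (k : ℂ) : Prop :=
  ∃ φ : A.domain, φ ≠ 0 ∧ A φ = k • (φ : E)

end BenjaminOno

end

/-! Put f = uφ and F = f̂. The growth allowed for φ and the weight on u leave f in L¹ ∩ L², so F is
continuous and square integrable. With the phase e^{-2πixξ}, every solution found below satisfies
(2πξ - k) φ̂ = χ_{ℝ⁺} F with φ ∈ L².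

Off the cut, G_k is an L² kernel with bounded symbol χ_{ℝ⁺}/(2πξ - k), so φ ∈ L² is immediate
(`isFourierPair_convolution`). For nonreal k, ⟨φ, uφ⟩ is real since u is, while Parseval gives it
imaginary part -Im k ‖φ‖²; hence φ = 0.

For real k ≠ 0 the identity comes from `norm_integral_sq_eq`. Pair φ̂ with a translate of F by ε.
Since u is real, this pairing is symmetric; inserting the equation cancels k and leaves 2πε ∫ conj
φ̂(ξ+ε) φ̂(ξ) = ∫_{(-ε,0]} conj φ̂(ξ+ε) F(ξ). Dividing by ε and letting ε → 0 yields 2π‖φ‖² =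
|F(0)|²/(-k), because φ̂ has right limit F(0)/(-k) at 0. For k > 0 the two sides have opposite
signs, so φ = 0; this also excludes positive eigenvalues.

On the cut, φ is a retarded (or advanced) integral of f minus an L² convolution, and its square
integrability must be earned. The vanishing of Im ⟨φ, uφ⟩ forces ∫ e^{-iλy} f(y) dy = 0
(`integral_conj_sub_mul_im`). The retarded integral can then be estimated from either end of the
line, so decay of f passes to φ; each pass gains s - s₁ until φ = O(1/|x|) (`decayRate_one`). At
that point the retarded integral lies in L¹ ∩ L², the Fourier equation holds, and the trace identity
with k = λ > 0 finishes. -/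

namespace BenjaminOno

/-! ### The `L²` Fourier transform as a relation between functions -/

/-- `ψ` is the `L²` Fourier transform of `φ`, as functions defined almost everywhere. -/
def IsFourierPair (φ ψ : ℝ → ℂ) : Prop :=
  ∃ Φ : L2, Φ =ᵐ[volume] φ ∧ (𝓕 Φ : L2) =ᵐ[volume] ψ

theorem continuous_fourier {f : ℝ → ℂ} (hf : Integrable f) : Continuous (𝓕 f) :=
  VectorFourier.fourierIntegral_continuous Real.continuous_fourierChar
    (by fun_prop) hf

theorem continuous_fourierInv {f : ℝ → ℂ} (hf : Integrable f) : Continuous (𝓕⁻ f) :=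
  VectorFourier.fourierIntegral_continuous Real.continuous_fourierChar
    (by fun_prop) hf

theorem integral_fourier_mul_eq_flip {f g : ℝ → ℂ} (hf : Integrable f) (hg : Integrable g) :
    ∫ ξ, 𝓕 f ξ * g ξ = ∫ x, f x * 𝓕 g x := by
  have := VectorFourier.integral_fourierIntegral_smul_eq_flip (e := Real.fourierChar)
    (μ := volume) (ν := volume) (L := innerₗ ℝ)
    Real.continuous_fourierChar (by fun_prop) hf hg
  simpa using! this

theorem integral_fourierInv_mul_eq_flip {f g : ℝ → ℂ} (hf : Integrable f) (hg : Integrable g) :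
    ∫ ξ, 𝓕⁻ f ξ * g ξ = ∫ x, f x * 𝓕⁻ g x := by
  have := integral_fourier_mul_eq_flip hf.comp_neg hg
  rw [Real.fourierInv_eq_fourier_comp_neg, this, ← integral_neg_eq_self]
  simp [Real.fourierInv_eq_fourier_neg]

/-- The `L²` transform and the Fourier integral define the same tempered distribution, so they agree
when tested against smooth compactly supported functions; both are locally integrable, hence equal
almost everywhere. -/
theorem IsFourierPair.of_integrable {f : ℝ → ℂ} (hf : Integrable f) (hf2 : MemLp f 2) :
    IsFourierPair f (𝓕 f) := by
  refine ⟨hf2.toLp f, hf2.coeFn_toLp, ?_⟩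
  refine ae_eq_of_integral_contDiff_smul_eq
    ((Lp.memLp _).locallyIntegrable (by norm_num))
    (continuous_fourier hf).locallyIntegrable ?_
  intro g hg hgc
  have hg₁ : HasCompactSupport (Complex.ofRealCLM ∘ g) := hgc.comp_left rfl
  have hg₂ : ContDiff ℝ ((⊤ : ℕ∞) : WithTop ℕ∞) (Complex.ofRealCLM ∘ g) := Complex.ofRealCLM.contDiff.comp hg
  have h := DFunLike.congr_fun (Lp.fourier_toTemperedDistribution_eq (hf2.toLp f))
    (hg₁.toSchwartzMap hg₂)
  rw [TemperedDistribution.fourier_apply, Lp.toTemperedDistribution_apply,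
    Lp.toTemperedDistribution_apply] at h
  have h1 : ∫ x, g x • (𝓕 (hf2.toLp f) : L2) x =
      ∫ x, (hg₁.toSchwartzMap hg₂) x • (𝓕 (hf2.toLp f) : L2) x := by
    congr with x
  rw [h1, ← h]
  have h2 : ∫ x, (𝓕 (hg₁.toSchwartzMap hg₂)) x • (hf2.toLp f) x
      = ∫ x, 𝓕 (hg₁.toSchwartzMap hg₂ : ℝ → ℂ) x * f x := by
    refine integral_congr_ae ?_
    filter_upwards [hf2.coeFn_toLp] with x hx
    rw [hx, smul_eq_mul, SchwartzMap.fourier_coe]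
  rw [h2, integral_fourier_mul_eq_flip (SchwartzMap.integrable _) hf]
  simp

theorem IsFourierPair.of_integrable_inv {f : ℝ → ℂ} (hf : Integrable f) (hf2 : MemLp f 2) :
    IsFourierPair (𝓕⁻ f) f := by
  refine ⟨𝓕⁻ (hf2.toLp f), ?_, ?_⟩
  swap
  · rw [FourierTransform.fourier_fourierInv_eq]
    exact hf2.coeFn_toLp
  refine ae_eq_of_integral_contDiff_smul_eq
    ((Lp.memLp _).locallyIntegrable (by norm_num))
    (continuous_fourierInv hf).locallyIntegrable ?_
  intro g hg hgc
  have hg₁ : HasCompactSupport (Complex.ofRealCLM ∘ g) := hgc.comp_left rfl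
  have hg₂ : ContDiff ℝ ((⊤ : ℕ∞) : WithTop ℕ∞) (Complex.ofRealCLM ∘ g) := Complex.ofRealCLM.contDiff.comp hg
  have h := DFunLike.congr_fun (Lp.fourierInv_toTemperedDistribution_eq (hf2.toLp f))
    (hg₁.toSchwartzMap hg₂)
  rw [TemperedDistribution.fourierInv_apply, Lp.toTemperedDistribution_apply,
    Lp.toTemperedDistribution_apply] at h
  have h1 : ∫ x, g x • (𝓕⁻ (hf2.toLp f) : L2) x =
      ∫ x, (hg₁.toSchwartzMap hg₂) x • (𝓕⁻ (hf2.toLp f) : L2) x := by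
    congr with x
  rw [h1, ← h]
  have h2 : ∫ x, (𝓕⁻ (hg₁.toSchwartzMap hg₂)) x • (hf2.toLp f) x
      = ∫ x, 𝓕⁻ (hg₁.toSchwartzMap hg₂ : ℝ → ℂ) x * f x := by
    refine integral_congr_ae ?_
    filter_upwards [hf2.coeFn_toLp] with x hx
    rw [hx, smul_eq_mul, SchwartzMap.fourierInv_coe]
  rw [h2, integral_fourierInv_mul_eq_flip (SchwartzMap.integrable _) hf]
  simp

namespace IsFourierPair

variable {φ ψ φ' ψ' : ℝ → ℂ}

theorem congr (h : IsFourierPair φ ψ) (h1 : φ =ᵐ[volume] φ') (h2 : ψ =ᵐ[volume] ψ') :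
    IsFourierPair φ' ψ' := by
  obtain ⟨Φ, a, b⟩ := h
  exact ⟨Φ, a.trans h1, b.trans h2⟩

theorem memLp_left (h : IsFourierPair φ ψ) : MemLp φ 2 := by
  obtain ⟨Φ, a, b⟩ := h
  exact (Lp.memLp Φ).ae_eq a

theorem memLp_right (h : IsFourierPair φ ψ) : MemLp ψ 2 := by
  obtain ⟨Φ, a, b⟩ := h
  exact (Lp.memLp (𝓕 Φ)).ae_eq b

theorem sub (h : IsFourierPair φ ψ) (h' : IsFourierPair φ' ψ') :
    IsFourierPair (fun x => φ x - φ' x) (fun x => ψ x - ψ' x) := by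
  obtain ⟨Φ, a, b⟩ := h
  obtain ⟨Φ', a', b'⟩ := h'
  refine ⟨Φ - Φ', ?_, ?_⟩
  · filter_upwards [Lp.coeFn_sub Φ Φ', a, a'] with x e1 e2 e3
    rw [e1, Pi.sub_apply, e2, e3]
  · have : 𝓕 (Φ - Φ') = 𝓕 Φ - 𝓕 Φ' := (Lp.fourierTransformₗᵢ ℝ ℂ).map_sub Φ Φ'
    rw [this]
    filter_upwards [Lp.coeFn_sub (𝓕 Φ) (𝓕 Φ'), b, b'] with x e1 e2 e3
    rw [e1, Pi.sub_apply, e2, e3]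

theorem integral_conj_mul (h : IsFourierPair φ ψ) (h' : IsFourierPair φ' ψ') :
    ∫ x, (starRingEnd ℂ) (φ x) * φ' x = ∫ x, (starRingEnd ℂ) (ψ x) * ψ' x := by
  obtain ⟨Φ, a, b⟩ := h
  obtain ⟨Φ', a', b'⟩ := h'
  have h := Lp.inner_fourier_eq Φ Φ'
  rw [L2.inner_def, L2.inner_def] at h
  have e1 : ∫ x, (starRingEnd ℂ) (φ x) * φ' x = ∫ x, inner ℂ (Φ x) (Φ' x) := by
    refine integral_congr_ae ?_
    filter_upwards [a, a'] with x e1 e2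
    rw [e1, e2, RCLike.inner_apply, mul_comm]
  have e2 : ∫ x, (starRingEnd ℂ) (ψ x) * ψ' x =
      ∫ x, inner ℂ ((𝓕 Φ : L2) x) ((𝓕 Φ' : L2) x) := by
    refine integral_congr_ae ?_
    filter_upwards [b, b'] with x e1 e2
    rw [e1, e2, RCLike.inner_apply, mul_comm]
  rw [e1, e2, h]

end IsFourierPair

theorem integral_conj_mul_self (φ : ℝ → ℂ) :
    ∫ x, (starRingEnd ℂ) (φ x) * φ x = ((∫ x, ‖φ x‖ ^ 2 : ℝ) : ℂ) := by
  rw [← integral_complex_ofReal]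
  congr with x
  rw [mul_comm, Complex.mul_conj, Complex.normSq_eq_norm_sq]

theorem IsFourierPair.integral_norm_sq {φ ψ : ℝ → ℂ} (h : IsFourierPair φ ψ) :
    ∫ x, ‖φ x‖ ^ 2 = ∫ x, ‖ψ x‖ ^ 2 := by
  have := h.integral_conj_mul h
  rw [integral_conj_mul_self, integral_conj_mul_self] at this
  exact_mod_cast this

theorem ae_eq_zero_of_integral_norm_sq {φ : ℝ → ℂ} (h : MemLp φ 2)
    (h0 : ∫ x, ‖φ x‖ ^ 2 = 0) : φ =ᵐ[volume] 0 := by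
  rw [integral_eq_zero_iff_of_nonneg (fun x => by positivity)
    ((memLp_two_iff_integrable_sq_norm h.1).1 h)] at h0
  filter_upwards [h0] with x hx
  simpa using hx

/-! ### Truncated symbols and convolution with square integrable kernels -/

theorem enorm_integral_mul_le {a b : ℝ → ℂ} (ha : AEStronglyMeasurable a)
    (hb : AEStronglyMeasurable b) :
    ‖∫ x, a x * b x‖ₑ ≤ eLpNorm a 2 volume * eLpNorm b 2 volume := by
  refine (enorm_integral_le_lintegral_enorm _).trans ?_
  rw [← eLpNorm_one_eq_lintegral_enorm]
  have h : eLpNorm (a • b) 1 volume ≤ eLpNorm a 2 volume * eLpNorm b 2 volume :=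
    eLpNorm_smul_le_mul_eLpNorm hb ha
  exact h

theorem integrable_mul_of_memLp_two {a b : ℝ → ℂ} (ha : MemLp a 2) (hb : MemLp b 2) :
    Integrable (fun x => a x * b x) :=
  ha.integrable_mul hb

theorem measurePreserving_const_sub (x : ℝ) :
    MeasurePreserving (fun y : ℝ => x - y) volume volume :=
  Measure.measurePreserving_sub_left volume x

theorem memLp_comp_const_sub {a : ℝ → ℂ} (ha : MemLp a 2) (x : ℝ) :
    MemLp (fun y => a (x - y)) 2 :=
  ha.comp_measurePreserving (measurePreserving_const_sub x)

/-- The restriction of `m` to `(-n, n]`. -/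
noncomputable def truncate (m : ℝ → ℂ) (n : ℕ) : ℝ → ℂ :=
  (Set.Ioc (-(n : ℝ)) n).indicator m

theorem memLp_truncate {m : ℝ → ℂ} (hm : MemLp m 2) (n : ℕ) : MemLp (truncate m n) 2 :=
  hm.indicator measurableSet_Ioc

theorem integrable_truncate {m : ℝ → ℂ} (hm : MemLp m 2) (n : ℕ) :
    Integrable (truncate m n) := by
  rw [truncate, integrable_indicator_iff measurableSet_Ioc]
  exact (hm.restrict _).integrable (by norm_num)

theorem norm_truncate_le (m : ℝ → ℂ) (n : ℕ) (ξ : ℝ) : ‖truncate m n ξ‖ ≤ ‖m ξ‖ :=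
  norm_indicator_le_norm_self _ _

theorem eventually_truncate_eq (m : ℝ → ℂ) (ξ : ℝ) :
    ∀ᶠ n : ℕ in atTop, truncate m n ξ = m ξ := by
  filter_upwards [tendsto_natCast_atTop_atTop.eventually_gt_atTop |ξ|] with n hn
  have := abs_lt.1 hn
  rw [truncate, Set.indicator_of_mem]
  exact ⟨this.1, this.2.le⟩

theorem tendsto_eLpNorm_truncate_sub {m : ℝ → ℂ} (hm : MemLp m 2) :
    Tendsto (fun n => eLpNorm (truncate m n - m) 2 volume) atTop (𝓝 0) := by
  have h0 : Tendsto (fun n : ℕ => ∫⁻ ξ, ‖(truncate m n - m) ξ‖ₑ ^ (2 : ℝ)) atTop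
      (𝓝 (∫⁻ ξ : ℝ, 0)) := by
    refine tendsto_lintegral_of_dominated_convergence' (fun ξ => ‖m ξ‖ₑ ^ (2 : ℝ)) ?_ ?_ ?_ ?_
    · intro n
      exact (((memLp_truncate hm n).sub hm).1.enorm).pow_const _
    · intro n
      refine ae_of_all _ fun ξ => ?_
      refine ENNReal.rpow_le_rpow ?_ (by norm_num)
      by_cases h : ξ ∈ Set.Ioc (-(n : ℝ)) n <;> simp [truncate, h]
    · have := lintegral_rpow_enorm_lt_top_of_eLpNorm_lt_top (by norm_num) (by norm_num) hm.2
      simpa using! this.ne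
    · refine ae_of_all _ fun ξ => tendsto_const_nhds.congr' ?_
      filter_upwards [eventually_truncate_eq m ξ] with n hn
      simp [hn]
  have h1 : ∀ n, eLpNorm (truncate m n - m) 2 volume =
      (∫⁻ ξ, ‖(truncate m n - m) ξ‖ₑ ^ (2 : ℝ)) ^ (1 / (2 : ℝ)) := by
    intro n
    rw [eLpNorm_eq_lintegral_rpow_enorm_toReal (by norm_num) (by norm_num)]
    simp
  simp_rw [h1]
  have := h0.ennrpow_const (1 / (2 : ℝ))
  simpa using this

theorem fourierInv_truncate (m : ℝ → ℂ) (n : ℕ) (x : ℝ) :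
    𝓕⁻ (truncate m n) x =
      ∫ ξ in (-(n : ℝ))..n, Complex.exp (2 * Real.pi * Complex.I * x * ξ) * m ξ := by
  rw [intervalIntegral.integral_of_le (by have : (0 : ℝ) ≤ n := by positivity
                                          linarith),
    ← integral_indicator measurableSet_Ioc, Real.fourierInv_eq']
  congr with ξ
  by_cases h : ξ ∈ Set.Ioc (-(n : ℝ)) n
  · simp only [truncate, h, Set.indicator_of_mem, smul_eq_mul]
    congr 2
    simp
    ring
  · simp [truncate, h]

section

variable {m G : ℝ → ℂ}

theorem tendsto_eLpNorm_fourierInv_truncate_sub (hm : MemLp m 2) {g : ℝ → ℂ}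
    (hg : IsFourierPair g m) :
    Tendsto (fun n => eLpNorm (𝓕⁻ (truncate m n) - g) 2 volume) atTop (𝓝 0) := by
  refine (tendsto_eLpNorm_truncate_sub hm).congr fun n => ?_
  obtain ⟨Φ, h1, h2⟩ := (IsFourierPair.of_integrable_inv (integrable_truncate hm n)
    (memLp_truncate hm n)).sub hg
  rw [← eLpNorm_congr_ae (show _ =ᵐ[volume] 𝓕⁻ (truncate m n) - g from h1),
    ← eLpNorm_congr_ae (show _ =ᵐ[volume] truncate m n - m from h2)]
  have := Lp.norm_fourier_eq Φ
  rw [Lp.norm_def, Lp.norm_def] at this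
  exact (ENNReal.toReal_eq_toReal_iff' (Lp.memLp _).2.ne (Lp.memLp _).2.ne).1 this

theorem exists_isFourierPair_of_memLp (hm : MemLp m 2) : ∃ g, IsFourierPair g m := by
  refine ⟨(𝓕⁻ (hm.toLp m) : L2), 𝓕⁻ (hm.toLp m), EventuallyEq.rfl, ?_⟩
  rw [FourierTransform.fourier_fourierInv_eq]
  exact hm.coeFn_toLp

/-- Identifies a conditionally convergent inversion integral with the `L²` inverse transform: the
truncated integrals converge in `L²`, so a subsequence converges almost everywhere, and its limit
must be the pointwise one. -/
theorem isFourierPair_of_tendsto (hm : MemLp m 2)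
    (hG : ∀ᵐ x : ℝ, Tendsto (fun R : ℝ =>
      ∫ ξ in (-R)..R, Complex.exp (2 * Real.pi * Complex.I * x * ξ) * m ξ) atTop (𝓝 (G x))) :
    IsFourierPair G m := by
  obtain ⟨g, hg⟩ := exists_isFourierPair_of_memLp hm
  have h1 := tendsto_eLpNorm_fourierInv_truncate_sub hm hg
  have h2 := tendstoInMeasure_of_tendsto_eLpNorm (by norm_num)
    (fun n => (continuous_fourierInv (integrable_truncate hm n)).aestronglyMeasurable)
    hg.memLp_left.1 h1
  obtain ⟨ns, hns, h3⟩ := h2.exists_seq_tendsto_ae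
  refine hg.congr ?_ EventuallyEq.rfl
  filter_upwards [h3, hG] with x h4 h5
  refine tendsto_nhds_unique h4 ?_
  simp_rw [fourierInv_truncate]
  exact h5.comp (tendsto_natCast_atTop_atTop.comp hns.tendsto_atTop)

/-- As a function of y, 𝓕⁻ a (x - y) is the Fourier transform of a modulation of a, so moving the
transform onto f gives the claim. -/
theorem integral_fourierInv_sub_mul {a f : ℝ → ℂ} (ha : Integrable a) (hf : Integrable f)
    (x : ℝ) : ∫ y, 𝓕⁻ a (x - y) * f y = 𝓕⁻ (fun ξ => a ξ * 𝓕 f ξ) x := by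
  have hb : Integrable (fun ξ : ℝ => Real.fourierChar (ξ * x) • a ξ) := by
    have := (Real.fourierIntegral_convergent_iff (μ := volume) (f := a) (-x)).2 ha
    simpa [mul_comm] using this
  have h1 : ∀ y, 𝓕⁻ a (x - y) = 𝓕 (fun ξ : ℝ => Real.fourierChar (ξ * x) • a ξ) y := by
    intro y
    rw [Real.fourierInv_eq, Real.fourier_eq]
    congr with ξ
    rw [smul_smul, ← AddChar.map_add_eq_mul]
    congr 2
    simp
    ring
  simp_rw [h1]
  rw [integral_fourier_mul_eq_flip hb hf, Real.fourierInv_eq]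
  congr with ξ
  simp [Circle.smul_def, mul_assoc, mul_comm x ξ]

/-- Convolution with a kernel that is the pointwise inverse Fourier transform of a bounded
square integrable symbol. -/
theorem isFourierPair_convolution (hm : MemLp m 2) {M : ℝ} (hM : ∀ ξ, ‖m ξ‖ ≤ M)
    (hG : IsFourierPair G m) {f : ℝ → ℂ} (hf : Integrable f) (hf2 : MemLp f 2) :
    IsFourierPair (fun x => ∫ y, G (x - y) * f y) (fun ξ => m ξ * 𝓕 f ξ) := by
  have hF := (IsFourierPair.of_integrable hf hf2).memLp_right
  have hmF1 : Integrable (fun ξ => m ξ * 𝓕 f ξ) := integrable_mul_of_memLp_two hm hF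
  have hmF2 : MemLp (fun ξ => m ξ * 𝓕 f ξ) 2 := by
    refine MemLp.of_le_mul (c := M) hF hmF1.1 (ae_of_all _ fun ξ => ?_)
    rw [norm_mul]
    exact mul_le_mul_of_nonneg_right (hM ξ) (norm_nonneg _)
  refine (IsFourierPair.of_integrable_inv hmF1 hmF2).congr (ae_of_all _ fun x => ?_)
    EventuallyEq.rfl
  -- The same sequence has two limits: by Cauchy–Schwarz in y here, and by dominated convergence in
  -- ξ in `h2`, where m · 𝓕 f is integrable as a product of two `L²` functions.
  have h1 : Tendsto (fun n => ∫ y, 𝓕⁻ (truncate m n) (x - y) * f y) atTop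
      (𝓝 (∫ y, G (x - y) * f y)) := by
    rw [tendsto_iff_edist_tendsto_0]
    have h0 := ENNReal.Tendsto.mul_const (tendsto_eLpNorm_fourierInv_truncate_sub hm hG)
      (Or.inr hf2.2.ne)
    rw [zero_mul] at h0
    refine tendsto_of_tendsto_of_tendsto_of_le_of_le tendsto_const_nhds h0
      (fun n => zero_le) fun n => ?_
    have hn : MemLp (𝓕⁻ (truncate m n)) 2 :=
      (IsFourierPair.of_integrable_inv (integrable_truncate hm n) (memLp_truncate hm n)).memLp_left
    have hd := hn.sub hG.memLp_left
    have e1 : eLpNorm (𝓕⁻ (truncate m n) - G) 2 volume =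
        eLpNorm (fun y => (𝓕⁻ (truncate m n) - G) (x - y)) 2 volume :=
      (eLpNorm_comp_measurePreserving hd.1 (measurePreserving_const_sub x)).symm
    simp only [edist_eq_enorm_sub]
    rw [e1, ← integral_sub (integrable_mul_of_memLp_two (memLp_comp_const_sub hn x) hf2)
      (integrable_mul_of_memLp_two (memLp_comp_const_sub hG.memLp_left x) hf2)]
    refine le_trans (le_of_eq ?_)
      (enorm_integral_mul_le (memLp_comp_const_sub hd x).1 hf2.1)
    congr 2 with y
    simp [sub_mul]
  have h2 : Tendsto (fun n => ∫ y, 𝓕⁻ (truncate m n) (x - y) * f y) atTop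
      (𝓝 (𝓕⁻ (fun ξ => m ξ * 𝓕 f ξ) x)) := by
    simp_rw [fun n => integral_fourierInv_sub_mul (integrable_truncate hm n) hf x,
      Real.fourierInv_eq]
    refine tendsto_integral_of_dominated_convergence (fun ξ => ‖m ξ * 𝓕 f ξ‖) ?_ hmF1.norm ?_ ?_
    · intro n
      refine AEStronglyMeasurable.smul ?_ ((memLp_truncate hm n).1.mul hF.1)
      exact (Continuous.aestronglyMeasurable (by fun_prop))
    · intro n
      refine ae_of_all _ fun ξ => ?_
      rw [Circle.norm_smul, norm_mul, norm_mul]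
      exact mul_le_mul_of_nonneg_right (norm_truncate_le m n ξ) (norm_nonneg _)
    · refine ae_of_all _ fun ξ => tendsto_const_nhds.congr' ?_
      filter_upwards [eventually_truncate_eq m ξ] with n hn
      simp [hn]
  exact tendsto_nhds_unique h2 h1

end

/-! ### Convergence and 1/|x| bounds for the oscillatory kernel integrals -/

theorem exists_mul_one_add_le_norm_sub {k : ℂ} (hk : k ∉ ((↑) : ℝ → ℂ) '' Set.Ici 0) :
    ∃ c : ℝ, 0 < c ∧ ∀ ξ : ℝ, 0 ≤ ξ → c * (1 + ξ) ≤ ‖(ξ : ℂ) - k‖ := by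
  have hcl : IsClosed (((↑) : ℝ → ℂ) '' Set.Ici 0) :=
    Complex.isometry_ofReal.isClosedEmbedding.isClosedMap _ isClosed_Ici
  obtain ⟨d, hd, hdk⟩ := Metric.isOpen_iff.1 hcl.isOpen_compl k hk
  have h1 : ∀ ξ : ℝ, 0 ≤ ξ → d ≤ ‖(ξ : ℂ) - k‖ := by
    intro ξ hξ
    by_contra! h
    exact hdk (by rwa [Metric.mem_ball, dist_eq_norm]) ⟨ξ, hξ, rfl⟩
  have hK : 0 < d / (d + 1 + ‖k‖) := by positivity
  -- With N = |ξ - k|, the bounds d ≤ N and ξ ≤ N + ‖k‖ give d(1 + ξ) ≤ N(d + 1 + ‖k‖).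
  refine ⟨d / (d + 1 + ‖k‖), hK, fun ξ hξ => ?_⟩
  have h2 : ξ ≤ ‖(ξ : ℂ) - k‖ + ‖k‖ := by
    have := norm_sub_norm_le (ξ : ℂ) k
    rw [Complex.norm_of_nonneg hξ] at this
    linarith
  have h3 := h1 ξ hξ
  rw [div_mul_eq_mul_div, div_le_iff₀ (by positivity)]
  nlinarith [norm_nonneg k]

theorem integrable_one_add_abs_rpow {r : ℝ} (hr : 1 < r) :
    Integrable (fun x : ℝ => (1 + |x|) ^ (-r)) := by
  have := integrable_one_add_norm (E := ℝ) (μ := volume) (r := r) (by simpa using hr)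
  simpa using this

theorem memLp_one_add_abs_rpow {r : ℝ} (hr : 1 / 2 < r) :
    MemLp (fun x : ℝ => (1 + |x|) ^ (-r)) 2 := by
  have hc : Continuous (fun x : ℝ => (1 + |x|) ^ (-r)) :=
    Continuous.rpow_const (by fun_prop) fun x => Or.inl (by positivity)
  rw [memLp_two_iff_integrable_sq_norm hc.aestronglyMeasurable]
  refine (integrable_one_add_abs_rpow (r := 2 * r) (by linarith)).congr (ae_of_all _ fun x => ?_)
  have h : 0 < 1 + |x| := by positivity
  simp only
  rw [Real.norm_of_nonneg (by positivity), ← Real.rpow_natCast, ← Real.rpow_mul h.le]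
  congr 1
  push_cast
  ring

theorem norm_exp_I_mul (x ξ : ℝ) : ‖Complex.exp (Complex.I * x * ξ)‖ = 1 := by
  have : Complex.I * x * ξ = ((x * ξ : ℝ) : ℂ) * Complex.I := by push_cast; ring
  rw [this, Complex.norm_exp_ofReal_mul_I]

/-- One integration by parts: it produces a factor 1/(ix) and turns 1/(ξ - k) into an integrand of
size (1 + ξ)⁻². The boundary term at R vanishes in the limit, and the rest is bounded by a constant
over |x|. -/
theorem exists_tendsto_integral_exp_div {k : ℂ} (hk : k ∉ ((↑) : ℝ → ℂ) '' Set.Ici 0) :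
    ∃ C : ℝ, ∀ x : ℝ, x ≠ 0 → ∃ z : ℂ, ‖z‖ ≤ C / |x| ∧
      Tendsto (fun R : ℝ => ∫ ξ in (0 : ℝ)..R,
        Complex.exp (Complex.I * (x : ℂ) * (ξ : ℂ)) / ((ξ : ℂ) - k)) atTop (𝓝 z) := by
  obtain ⟨c, hc, hck⟩ := exists_mul_one_add_le_norm_sub hk
  set J : ℝ := ∫ x : ℝ, (1 + |x|) ^ (-2 : ℝ)
  refine ⟨1 / c + 1 / c ^ 2 * J, fun x hx => ?_⟩
  have hx' : 0 < |x| := abs_pos.2 hx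
  have hxI : Complex.I * (x : ℂ) ≠ 0 := mul_ne_zero Complex.I_ne_zero (by exact_mod_cast hx)
  have hxn : ‖Complex.I * (x : ℂ)‖ = |x| := by simp
  have hne : ∀ ξ : ℝ, 0 ≤ ξ → (ξ : ℂ) - k ≠ 0 := by
    intro ξ hξ h0
    have := hck ξ hξ
    rw [h0, norm_zero] at this
    have : 0 < c * (1 + ξ) := by positivity
    linarith
  let p : ℝ → ℂ := fun ξ => ((ξ : ℂ) - k)⁻¹
  let p' : ℝ → ℂ := fun ξ => -1 / ((ξ : ℂ) - k) ^ 2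
  let v : ℝ → ℂ := fun ξ => Complex.exp (Complex.I * x * ξ) / (Complex.I * x)
  let v' : ℝ → ℂ := fun ξ => Complex.exp (Complex.I * x * ξ)
  have hp : ∀ ξ : ℝ, 0 ≤ ξ → HasDerivAt p (p' ξ) ξ := by
    intro ξ hξ
    exact ((Complex.ofRealCLM.hasDerivAt (x := ξ)).sub_const k).inv (hne ξ hξ)
  have hv : ∀ ξ : ℝ, HasDerivAt v (v' ξ) ξ := by
    intro ξ
    have h1 : HasDerivAt (fun ξ : ℝ => Complex.I * x * (ξ : ℂ)) (Complex.I * x * 1) ξ :=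
      (Complex.ofRealCLM.hasDerivAt (x := ξ)).const_mul (Complex.I * x)
    have h2 := h1.cexp.div_const (Complex.I * x)
    refine h2.congr_deriv ?_
    simp only [v']
    rw [mul_one, mul_div_assoc, div_self hxI, mul_one]
  have hp'c : ContinuousOn p' (Set.Ici 0) := by
    refine continuousOn_const.div (Continuous.continuousOn (by fun_prop)) ?_
    intro ξ hξ
    exact pow_ne_zero _ (hne ξ hξ)
  have hvc : Continuous v := by
    simp only [v]
    fun_prop
  have hv'c : Continuous v' := by
    simp only [v']
    fun_prop
  have hbound : ∀ ξ : ℝ, 0 ≤ ξ → ‖p' ξ * v ξ‖ ≤ 1 / c ^ 2 / |x| * (1 + |ξ|) ^ (-2 : ℝ) := by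
    intro ξ hξ
    have h1 := hck ξ hξ
    simp only [p', v]
    rw [norm_mul, norm_div, norm_div, norm_exp_I_mul, hxn, norm_neg, norm_one, norm_pow,
      abs_of_nonneg hξ, Real.rpow_neg (by positivity), Real.rpow_two]
    have h2 : (c * (1 + ξ)) ^ 2 ≤ ‖(ξ : ℂ) - k‖ ^ 2 := by gcongr
    calc 1 / ‖(ξ : ℂ) - k‖ ^ 2 * (1 / |x|) ≤ 1 / (c * (1 + ξ)) ^ 2 * (1 / |x|) := by
          gcongr
      _ = _ := by field_simp
  have hJ : Integrable (fun ξ : ℝ => 1 / c ^ 2 / |x| * (1 + |ξ|) ^ (-2 : ℝ)) :=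
    (integrable_one_add_abs_rpow (by norm_num)).const_mul _
  have hint : IntegrableOn (fun ξ => p' ξ * v ξ) (Set.Ioi 0) := by
    refine Integrable.mono' hJ.integrableOn ?_ ?_
    · exact ((hp'c.mono Set.Ioi_subset_Ici_self).mul hvc.continuousOn).aestronglyMeasurable
        measurableSet_Ioi
    · filter_upwards [ae_restrict_mem measurableSet_Ioi] with ξ hξ
      exact hbound ξ (le_of_lt hξ)
  refine ⟨0 - p 0 * v 0 - ∫ ξ in Set.Ioi 0, p' ξ * v ξ, ?_, ?_⟩
  · have h0 : ‖p 0 * v 0‖ ≤ 1 / c / |x| := by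
      have h1 := hck 0 le_rfl
      simp only [p, v]
      rw [norm_mul, norm_inv, norm_div, norm_exp_I_mul, hxn, div_eq_mul_inv (1 / c),
        one_div |x|]
      gcongr
      rw [← one_div]
      gcongr
      simpa using h1
    have h2 : ‖∫ ξ in Set.Ioi 0, p' ξ * v ξ‖ ≤ 1 / c ^ 2 / |x| * J := by
      refine (norm_integral_le_of_norm_le hJ.integrableOn ?_).trans ?_
      · filter_upwards [ae_restrict_mem measurableSet_Ioi] with ξ hξ
        exact hbound ξ (le_of_lt hξ)
      · rw [← integral_const_mul]
        exact setIntegral_le_integral hJ (ae_of_all _ fun ξ => by positivity)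
    calc _ ≤ ‖(0 : ℂ) - p 0 * v 0‖ + ‖∫ ξ in Set.Ioi 0, p' ξ * v ξ‖ := norm_sub_le _ _
      _ ≤ 1 / c / |x| + 1 / c ^ 2 / |x| * J := by
        rw [zero_sub, norm_neg]
        exact add_le_add h0 h2
      _ = _ := by ring
  · have heq : ∀ᶠ R : ℝ in atTop, p R * v R - p 0 * v 0 - ∫ ξ in (0 : ℝ)..R, p' ξ * v ξ =
        ∫ ξ in (0 : ℝ)..R, Complex.exp (Complex.I * (x : ℂ) * (ξ : ℂ)) / ((ξ : ℂ) - k) := by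
      filter_upwards [eventually_ge_atTop 0] with R hR
      rw [← intervalIntegral.integral_mul_deriv_eq_deriv_mul (u := p) (v := v) (u' := p')
        (v' := v')]
      · congr with ξ
        simp only [p, v']
        rw [div_eq_mul_inv, mul_comm]
      · intro ξ hξ
        rw [Set.uIcc_of_le hR] at hξ
        exact hp ξ hξ.1
      · exact fun ξ _ => hv ξ
      · refine (hp'c.mono fun ξ hξ => ?_).intervalIntegrable
        rw [Set.uIcc_of_le hR] at hξ
        exact hξ.1
      · exact hv'c.intervalIntegrable _ _
    refine Tendsto.congr' heq ?_
    refine Tendsto.sub (Tendsto.sub ?_ tendsto_const_nhds)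
      (intervalIntegral_tendsto_integral_Ioi 0 hint tendsto_id)
    rw [tendsto_zero_iff_norm_tendsto_zero]
    have hlim : Tendsto (fun R : ℝ => (c * |x|)⁻¹ * (1 + R)⁻¹) atTop (𝓝 ((c * |x|)⁻¹ * 0)) :=
      (tendsto_inv_atTop_zero.comp (tendsto_atTop_add_const_left _ _ tendsto_id)).const_mul _
    rw [mul_zero] at hlim
    refine tendsto_of_tendsto_of_tendsto_of_le_of_le' tendsto_const_nhds hlim
      (Eventually.of_forall fun R => norm_nonneg _) ?_
    filter_upwards [eventually_ge_atTop 0] with R hR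
    have h1 := hck R hR
    simp only [p, v]
    rw [norm_mul, norm_inv, norm_div, norm_exp_I_mul, hxn]
    calc ‖(R : ℂ) - k‖⁻¹ * (1 / |x|) ≤ (c * (1 + R))⁻¹ * (1 / |x|) := by gcongr
      _ = _ := by field_simp

theorem tendsto_kernelPos {k : ℂ} (hk : k ∉ ((↑) : ℝ → ℂ) '' Set.Ici 0) {x : ℝ} (hx : x ≠ 0) :
    Tendsto (fun R : ℝ => (1 / (2 * (Real.pi : ℂ))) *
      ∫ ξ in (0 : ℝ)..R, Complex.exp (Complex.I * (x : ℂ) * (ξ : ℂ)) / ((ξ : ℂ) - k))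
      atTop (𝓝 (kernelPos k x)) := by
  obtain ⟨C, hC⟩ := exists_tendsto_integral_exp_div hk
  obtain ⟨z, -, hz⟩ := hC x hx
  exact tendsto_nhds_limUnder ⟨_, hz.const_mul _⟩

theorem neg_notMem_image {l : ℝ} (hl : 0 < l) :
    ((-l : ℝ) : ℂ) ∉ ((↑) : ℝ → ℂ) '' Set.Ici 0 := by
  rintro ⟨t, ht, h⟩
  have : t = -l := by exact_mod_cast h
  have : 0 ≤ t := ht
  linarith

/-- Reflection ξ ↦ -ξ reduces the kernel on the negative half line at λ > 0 to the one on the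
positive half line at -λ, which is off the cut. -/
theorem integral_exp_div_neg (l x R : ℝ) :
    ∫ ξ in (-R)..(0 : ℝ), Complex.exp (Complex.I * (x : ℂ) * (ξ : ℂ)) / ((ξ : ℂ) - (l : ℂ)) =
      -∫ ξ in (0 : ℝ)..R,
        Complex.exp (Complex.I * ((-x : ℝ) : ℂ) * (ξ : ℂ)) / ((ξ : ℂ) - ((-l : ℝ) : ℂ)) := by
  have := intervalIntegral.integral_comp_neg (a := 0) (b := R)
    (fun ξ : ℝ => Complex.exp (Complex.I * (x : ℂ) * (ξ : ℂ)) / ((ξ : ℂ) - (l : ℂ)))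
  rw [neg_zero] at this
  rw [← this, ← intervalIntegral.integral_neg]
  congr with ξ
  push_cast
  rw [← div_neg]
  congr 2 <;> ring

theorem exists_tendsto_kernelNeg {l : ℝ} (hl : 0 < l) :
    ∃ C : ℝ, ∀ x : ℝ, x ≠ 0 → ‖kernelNeg l x‖ ≤ C / |x| ∧
      Tendsto (fun R : ℝ => (1 / (2 * (Real.pi : ℂ))) *
        ∫ ξ in (-R)..(0 : ℝ), Complex.exp (Complex.I * (x : ℂ) * (ξ : ℂ)) / ((ξ : ℂ) - l))
        atTop (𝓝 (kernelNeg l x)) := by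
  obtain ⟨C, hC⟩ := exists_tendsto_integral_exp_div (neg_notMem_image hl)
  refine ⟨‖(1 / (2 * (Real.pi : ℂ)))‖ * C, fun x hx => ?_⟩
  obtain ⟨z, hzC, hz⟩ := hC (-x) (neg_ne_zero.2 hx)
  have h1 : Tendsto (fun R : ℝ => (1 / (2 * (Real.pi : ℂ))) *
        ∫ ξ in (-R)..(0 : ℝ), Complex.exp (Complex.I * (x : ℂ) * (ξ : ℂ)) / ((ξ : ℂ) - l))
        atTop (𝓝 ((1 / (2 * (Real.pi : ℂ))) * -z)) := by
    simp_rw [integral_exp_div_neg]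
    exact hz.neg.const_mul _
  have h2 : kernelNeg l x = (1 / (2 * (Real.pi : ℂ))) * -z := h1.limUnder_eq
  refine ⟨?_, h2 ▸ h1⟩
  rw [h2, norm_mul, norm_neg, mul_div_assoc]
  rw [abs_neg] at hzC
  gcongr

/-! ### Symbols of the kernels -/

/-- The symbol `χ_{ℝ⁺}(ξ) / (2πξ - k)` of convolution with `G_k`. -/
noncomputable def symbolPos (k : ℂ) (ξ : ℝ) : ℂ := chiPos ξ / (2 * Real.pi * ξ - k)

/-- The symbol `χ_{(-∞,0]}(ξ) / (2πξ - k)`. -/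
noncomputable def symbolNeg (k : ℂ) (ξ : ℝ) : ℂ := (1 - chiPos ξ) / (2 * Real.pi * ξ - k)

theorem measurable_chiPos : Measurable chiPos :=
  measurable_const.indicator measurableSet_Ioi

theorem chiPos_of_pos {ξ : ℝ} (h : 0 < ξ) : chiPos ξ = 1 := by simp [chiPos, h]

theorem chiPos_of_nonpos {ξ : ℝ} (h : ξ ≤ 0) : chiPos ξ = 0 := by simp [chiPos, h]

theorem measurable_symbolPos (k : ℂ) : Measurable (symbolPos k) :=
  measurable_chiPos.div (by fun_prop)

theorem measurable_symbolNeg (k : ℂ) : Measurable (symbolNeg k) :=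
  (measurable_const.sub measurable_chiPos).div (by fun_prop)

theorem exists_norm_symbolPos_le {k : ℂ} (hk : k ∉ ((↑) : ℝ → ℂ) '' Set.Ici 0) :
    ∃ C : ℝ, ∀ ξ, ‖symbolPos k ξ‖ ≤ C * ‖(1 + |ξ|) ^ (-1 : ℝ)‖ := by
  obtain ⟨c, hc, hck⟩ := exists_mul_one_add_le_norm_sub hk
  refine ⟨1 / c, fun ξ => ?_⟩
  rw [Real.norm_of_nonneg (by positivity)]
  rcases le_or_gt ξ 0 with h | h
  · rw [symbolPos, chiPos_of_nonpos h, zero_div, norm_zero]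
    positivity
  · have h1 := hck (2 * Real.pi * ξ) (by positivity)
    push_cast at h1
    have h2 : c * (1 + ξ) ≤ c * (1 + 2 * Real.pi * ξ) := by
      gcongr
      nlinarith [Real.pi_gt_three]
    rw [symbolPos, chiPos_of_pos h, norm_div, norm_one, Real.rpow_neg_one, abs_of_pos h]
    calc 1 / ‖2 * (Real.pi : ℂ) * ξ - k‖ ≤ 1 / (c * (1 + ξ)) := by
          gcongr
          exact h2.trans h1
      _ = _ := by field_simp

theorem exists_norm_symbolNeg_le {l : ℝ} (hl : 0 < l) :
    ∃ C : ℝ, ∀ ξ, ‖symbolNeg l ξ‖ ≤ C * ‖(1 + |ξ|) ^ (-1 : ℝ)‖ := by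
  obtain ⟨C, hC⟩ := exists_norm_symbolPos_le (neg_notMem_image hl)
  -- The reflection argument misses ξ = 0, where `symbolPos` vanishes but `symbolNeg` equals -1/l;
  -- the maximum covers that point.
  refine ⟨max C (1 / l), fun ξ => ?_⟩
  rcases lt_trichotomy ξ 0 with h | h | h
  · have h1 := hC (-ξ)
    have h2 : symbolNeg l ξ = -symbolPos ((-l : ℝ) : ℂ) (-ξ) := by
      rw [symbolNeg, symbolPos, chiPos_of_nonpos h.le, chiPos_of_pos (neg_pos.2 h), ← div_neg]
      push_cast
      congr 1 <;> ring
    rw [h2, norm_neg]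
    rw [abs_neg] at h1
    exact h1.trans (by gcongr; exact le_max_left _ _)
  · subst h
    rw [symbolNeg, chiPos_of_nonpos le_rfl]
    simp [abs_of_pos hl]
  · rw [symbolNeg, chiPos_of_pos h, sub_self, zero_div, norm_zero]
    have : 0 < 1 / l := by positivity
    have : 0 < max C (1 / l) := lt_max_of_lt_right this
    positivity

theorem memLp_symbolPos {k : ℂ} (hk : k ∉ ((↑) : ℝ → ℂ) '' Set.Ici 0) :
    MemLp (symbolPos k) 2 := by
  obtain ⟨C, hC⟩ := exists_norm_symbolPos_le hk
  exact (memLp_one_add_abs_rpow (r := 1) (by norm_num)).of_le_mul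
    (measurable_symbolPos k).aestronglyMeasurable (ae_of_all _ hC)

theorem memLp_symbolNeg {l : ℝ} (hl : 0 < l) : MemLp (symbolNeg l) 2 := by
  obtain ⟨C, hC⟩ := exists_norm_symbolNeg_le hl
  exact (memLp_one_add_abs_rpow (r := 1) (by norm_num)).of_le_mul
    (measurable_symbolNeg l).aestronglyMeasurable (ae_of_all _ hC)

theorem exists_bound_of_norm_le {m : ℝ → ℂ}
    (h : ∃ C : ℝ, ∀ ξ, ‖m ξ‖ ≤ C * ‖(1 + |ξ|) ^ (-1 : ℝ)‖) : ∃ M, ∀ ξ, ‖m ξ‖ ≤ M := by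
  obtain ⟨C, hC⟩ := h
  have hC0 : 0 ≤ C := by
    have := (norm_nonneg _).trans (hC 0)
    simpa using this
  refine ⟨C, fun ξ => (hC ξ).trans ?_⟩
  rw [Real.norm_of_nonneg (by positivity), Real.rpow_neg_one]
  refine mul_le_of_le_one_right hC0 (inv_le_one_of_one_le₀ ?_)
  linarith [abs_nonneg ξ]

/-- The substitution ξ ↦ 2πξ passes between the phases e^{ixξ} and e^{2πixξ}, and accounts exactly
for the prefactor 1/(2π) of the kernels. -/
theorem integral_exp_div_scale (k : ℂ) (x a b : ℝ) :
    ∫ ξ in a..b, Complex.exp (2 * Real.pi * Complex.I * x * ξ) / (2 * Real.pi * ξ - k) =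
      (1 / (2 * (Real.pi : ℂ))) * ∫ ξ in (2 * Real.pi * a)..(2 * Real.pi * b),
        Complex.exp (Complex.I * (x : ℂ) * (ξ : ℂ)) / ((ξ : ℂ) - k) := by
  have := intervalIntegral.integral_comp_mul_left (a := a) (b := b) (c := 2 * Real.pi)
    (fun ξ : ℝ => Complex.exp (Complex.I * (x : ℂ) * (ξ : ℂ)) / ((ξ : ℂ) - k)) (by positivity)
  rw [Complex.real_smul] at this
  push_cast at this
  rw [one_div, ← this]
  congr with ξ
  congr 2
  ring

theorem ae_ne_zero : ∀ᵐ x : ℝ, x ≠ 0 := by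
  simp [ae_iff]

theorem isFourierPair_kernelPos {k : ℂ} (hk : k ∉ ((↑) : ℝ → ℂ) '' Set.Ici 0) :
    IsFourierPair (kernelPos k) (symbolPos k) := by
  refine isFourierPair_of_tendsto (memLp_symbolPos hk) ?_
  filter_upwards [ae_ne_zero] with x hx
  have h := (tendsto_kernelPos hk hx).comp
    (tendsto_id.const_mul_atTop (show 0 < 2 * Real.pi by positivity))
  refine h.congr' ?_
  filter_upwards [eventually_ge_atTop 0] with R hR
  have e1 := integral_exp_div_scale k x 0 R
  rw [mul_zero] at e1
  simp only [Function.comp, id]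
  rw [← e1, intervalIntegral.integral_of_le hR, intervalIntegral.integral_of_le (by linarith),
    ← integral_indicator measurableSet_Ioc, ← integral_indicator measurableSet_Ioc]
  congr with ξ
  simp only [Set.indicator, symbolPos, Set.mem_Ioc]
  rcases le_or_gt ξ 0 with h0 | h0
  · simp [chiPos_of_nonpos h0, not_lt.2 h0]
  · simp [chiPos_of_pos h0, h0, show -R < ξ by linarith, div_eq_mul_inv]

theorem isFourierPair_kernelNeg {l : ℝ} (hl : 0 < l) :
    IsFourierPair (kernelNeg l) (symbolNeg l) := by
  refine isFourierPair_of_tendsto (memLp_symbolNeg hl) ?_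
  obtain ⟨C, hC⟩ := exists_tendsto_kernelNeg hl
  filter_upwards [ae_ne_zero] with x hx
  have h := (hC x hx).2.comp
    (tendsto_id.const_mul_atTop (show 0 < 2 * Real.pi by positivity))
  refine h.congr' ?_
  filter_upwards [eventually_ge_atTop 0] with R hR
  have e1 := integral_exp_div_scale l x (-R) 0
  rw [mul_zero, mul_neg] at e1
  simp only [Function.comp, id]
  rw [← e1, intervalIntegral.integral_of_le (by linarith),
    intervalIntegral.integral_of_le (by linarith),
    ← integral_indicator measurableSet_Ioc, ← integral_indicator measurableSet_Ioc]
  congr with ξ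
  simp only [Set.indicator, symbolNeg, Set.mem_Ioc]
  rcases le_or_gt ξ 0 with h0 | h0
  · simp [chiPos_of_nonpos h0, h0, show ξ ≤ R by linarith, div_eq_mul_inv]
  · simp [chiPos_of_pos h0, not_le.2 h0]

/-! ### The trace identity -/

theorem tendsto_integral_conj_translate_mul {g : ℝ → ℂ} (hg : MemLp g 2) :
    Tendsto (fun ε : ℝ => ∫ ξ, (starRingEnd ℂ) (g (ξ + ε)) * g ξ) (𝓝 0)
      (𝓝 (∫ ξ, (starRingEnd ℂ) (g ξ) * g ξ)) := by
  have hmp : ∀ ε : ℝ, MeasurePreserving (fun ξ : ℝ => ξ + ε) volume volume :=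
    fun ε => measurePreserving_add_right volume ε
  let T : C(ℝ, C(ℝ, ℝ)) := (ContinuousMap.mk (fun a : ℝ × ℝ => a.2 + a.1) (by fun_prop)).curry
  have h1 : Tendsto (fun ε : ℝ => Lp.compMeasurePreserving (T ε) (hmp ε) (hg.toLp g)) (𝓝 0)
      (𝓝 (Lp.compMeasurePreserving (T 0) (hmp 0) (hg.toLp g))) :=
    tendsto_const_nhds.compMeasurePreservingLp (T.continuous.tendsto 0) hmp (hmp 0) (by norm_num)
  have h2 := h1.inner (𝕜 := ℂ) (tendsto_const_nhds (x := hg.toLp g))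
  have h3 : ∀ ε : ℝ, inner ℂ (Lp.compMeasurePreserving (T ε) (hmp ε) (hg.toLp g)) (hg.toLp g) =
      ∫ ξ, (starRingEnd ℂ) (g (ξ + ε)) * g ξ := by
    intro ε
    rw [L2.inner_def]
    refine integral_congr_ae ?_
    filter_upwards [hg.coeFn_toLp, Lp.coeFn_compMeasurePreserving (hg.toLp g) (hmp ε),
      (hmp ε).quasiMeasurePreserving.ae hg.coeFn_toLp] with ξ e1 e2 e3
    rw [e1, RCLike.inner_apply, mul_comm]
    congr 2
    exact e2.trans e3
  simp_rw [h3] at h2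
  simpa using h2

/-- Averages over `(-ε, 0]` of a function `H ξ ε` that is close to `z` near the origin. -/
theorem tendsto_average_of_near {H : ℝ → ℝ → ℂ} {z : ℂ}
    (hH : ∀ η > 0, ∃ δ > 0, ∀ ε, 0 < ε → ε < δ → ∀ ξ ∈ Set.Ioc (-ε) 0, ‖H ξ ε - z‖ ≤ η)
    (hi : ∀ ε, 0 < ε → IntegrableOn (fun ξ => H ξ ε) (Set.Ioc (-ε) 0)) :
    Tendsto (fun ε : ℝ => (ε : ℂ)⁻¹ * ∫ ξ in Set.Ioc (-ε) 0, H ξ ε) (𝓝[>] 0) (𝓝 z) := by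
  rw [Metric.tendsto_nhdsWithin_nhds]
  intro η hη
  obtain ⟨δ, hδ, h⟩ := hH (η / 2) (by positivity)
  refine ⟨δ, hδ, fun ε hε hεδ => ?_⟩
  have hε0 : 0 < ε := hε
  have hεδ' : ε < δ := by simpa [abs_of_pos hε0] using hεδ
  have hεc : (ε : ℂ) ≠ 0 := by exact_mod_cast hε0.ne'
  have hfin : volume (Set.Ioc (-ε) 0) ≠ ⊤ := by simp
  have e1 : (ε : ℂ)⁻¹ * (∫ ξ in Set.Ioc (-ε) 0, H ξ ε) - z =
      (ε : ℂ)⁻¹ * ∫ ξ in Set.Ioc (-ε) 0, (H ξ ε - z) := by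
    rw [integral_sub (hi ε hε0) (integrableOn_const hfin), setIntegral_const]
    simp only [Measure.real, Real.volume_Ioc, zero_sub, neg_neg]
    rw [ENNReal.toReal_ofReal hε0.le, Complex.real_smul]
    field_simp
  rw [dist_eq_norm, e1, norm_mul, norm_inv, Complex.norm_of_nonneg hε0.le]
  have h2 := norm_setIntegral_le_of_norm_le_const (C := η / 2) (f := fun ξ => H ξ ε - z)
    (hfin.lt_top) (h ε hε0 hεδ')
  simp only [Measure.real, Real.volume_Ioc, zero_sub, neg_neg] at h2
  rw [ENNReal.toReal_ofReal hε0.le] at h2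
  calc ε⁻¹ * _ ≤ ε⁻¹ * (η / 2 * ε) := by gcongr
    _ = η / 2 := by field_simp
    _ < η := by linarith

theorem fourier_modulate (f : ℝ → ℂ) (ε ξ : ℝ) :
    𝓕 (fun x : ℝ => (Real.fourierChar (ε * x) : ℂ) * f x) ξ = 𝓕 f (ξ - ε) := by
  rw [Real.fourier_eq, Real.fourier_eq]
  congr with x
  rw [Circle.smul_def, Circle.smul_def, smul_eq_mul, smul_eq_mul, ← mul_assoc, ← Circle.coe_mul,
    ← AddChar.map_add_eq_mul]
  congr 3
  simp
  ring

theorem norm_fourierChar_mul (t : ℝ) (z : ℂ) : ‖(Real.fourierChar t : ℂ) * z‖ = ‖z‖ := by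
  rw [norm_mul, Circle.norm_coe, one_mul]

theorem integrable_modulate {f : ℝ → ℂ} (hf : Integrable f) (ε : ℝ) :
    Integrable (fun x : ℝ => (Real.fourierChar (ε * x) : ℂ) * f x) := by
  refine (integrable_norm_iff ?_).1 (hf.norm.congr
    (ae_of_all _ fun x => (norm_fourierChar_mul _ _).symm))
  exact (Continuous.aestronglyMeasurable (by fun_prop)).mul hf.1

theorem memLp_modulate {f : ℝ → ℂ} (hf : MemLp f 2) (ε : ℝ) :
    MemLp (fun x : ℝ => (Real.fourierChar (ε * x) : ℂ) * f x) 2 := by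
  refine MemLp.of_le hf ?_ (ae_of_all _ fun x => (norm_fourierChar_mul _ _).le)
  exact (Continuous.aestronglyMeasurable (by fun_prop)).mul hf.1

theorem fourier_zero (f : ℝ → ℂ) : 𝓕 f 0 = ∫ x, f x := by
  simp [Real.fourier_eq]

theorem conj_ofReal_mul_ofReal_sub (k ξ : ℝ) :
    (starRingEnd ℂ) (2 * Real.pi * ξ - k : ℂ) = 2 * Real.pi * ξ - k := by
  have : (2 * Real.pi * ξ - k : ℂ) = ((2 * Real.pi * ξ - k : ℝ) : ℂ) := by push_cast; rfl
  rw [this, Complex.conj_ofReal]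

section

variable {u : ℝ → ℝ} {φ ψ : ℝ → ℂ} {k : ℝ}

theorem ae_two_pi_mul_ne (k : ℂ) : ∀ᵐ ξ : ℝ, (2 * Real.pi * ξ - k : ℂ) ≠ 0 := by
  have h : (volume : Measure ℝ) {k.re / (2 * Real.pi)} = 0 := by simp
  filter_upwards [compl_mem_ae_iff.2 h] with ξ hξ h0
  apply hξ
  have h1 := congrArg Complex.re h0
  have h2 : 2 * Real.pi * ξ - k.re = 0 := by
    simpa using h1
  rw [Set.mem_singleton_iff, eq_div_iff (by positivity)]
  linarith

theorem ae_eq_symbolPos_mul {k : ℂ} {F : ℝ → ℂ}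
    (hψ : ∀ᵐ ξ : ℝ, (2 * Real.pi * ξ - k : ℂ) * ψ ξ = chiPos ξ * F ξ) :
    ψ =ᵐ[volume] fun ξ => symbolPos k ξ * F ξ := by
  filter_upwards [hψ, ae_two_pi_mul_ne k] with ξ h1 h2
  rw [symbolPos, div_mul_eq_mul_div, ← h1, mul_div_cancel_left₀ _ h2]

/-- Since u is real, u|φ|² is real. By Parseval the left side is ∫ e^{2πiεx} u|φ|² dx, and the right
side is the conjugate of the same integral with -ε. -/
theorem integral_conj_mul_translate_comm (hf : Integrable fun x => (u x : ℂ) * φ x)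
    (hf2 : MemLp (fun x => (u x : ℂ) * φ x) 2) (h : IsFourierPair φ ψ) (ε : ℝ) :
    ∫ ξ, (starRingEnd ℂ) (ψ ξ) * 𝓕 (fun x => (u x : ℂ) * φ x) (ξ - ε) =
      ∫ ξ, ψ ξ * (starRingEnd ℂ) (𝓕 (fun x => (u x : ℂ) * φ x) (ξ + ε)) := by
  have key : ∀ ε : ℝ, ∫ ξ, (starRingEnd ℂ) (ψ ξ) * 𝓕 (fun x => (u x : ℂ) * φ x) (ξ - ε) =
      ∫ x : ℝ, (Real.fourierChar (ε * x) : ℂ) * ((u x * ‖φ x‖ ^ 2 : ℝ) : ℂ) := by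
    intro ε
    simp_rw [← fourier_modulate]
    rw [← h.integral_conj_mul (IsFourierPair.of_integrable (integrable_modulate hf ε)
      (memLp_modulate hf2 ε))]
    congr with x
    have : (starRingEnd ℂ) (φ x) * φ x = ((‖φ x‖ ^ 2 : ℝ) : ℂ) := by
      rw [mul_comm, Complex.mul_conj, Complex.normSq_eq_norm_sq]
    rw [Complex.ofReal_mul, ← this]
    ring
  have h2 := congrArg (starRingEnd ℂ) (key (-ε))
  rw [← integral_conj, ← integral_conj] at h2
  rw [key]
  refine Eq.trans ?_ (h2.symm.trans ?_)
  · congr with x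
    rw [map_mul (starRingEnd ℂ), Complex.conj_ofReal, ← Circle.coe_inv_eq_conj, ← AddChar.map_neg_eq_inv]
    congr 3
    ring
  · congr with ξ
    rw [map_mul, Complex.conj_conj, sub_neg_eq_add]

theorem continuousAt_conj_mul_div {F : ℝ → ℂ} (hF : Continuous F) (hk : k ≠ 0) {η : ℝ}
    (hη : 0 < η) : ∃ δ > 0, ∀ ε, 0 < ε → ε < δ → ∀ ξ ∈ Set.Ioc (-ε) 0,
      ‖(starRingEnd ℂ) (symbolPos k (ξ + ε) * F (ξ + ε)) * F ξ -
        (starRingEnd ℂ) (F 0 / (-k)) * F 0‖ ≤ η := by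
  let H : ℝ × ℝ → ℂ := fun p => (starRingEnd ℂ) (F p.1 / (2 * Real.pi * p.1 - k)) * F p.2
  have hH : ContinuousAt H (0, 0) := by
    have h1 : ContinuousAt (fun p : ℝ × ℝ => (2 * Real.pi * p.1 - k : ℂ)) (0, 0) := by fun_prop
    have h2 : ContinuousAt (fun p : ℝ × ℝ => F p.1 / (2 * Real.pi * p.1 - k : ℂ)) (0, 0) := by
      refine ContinuousAt.div (by fun_prop) h1 ?_
      simpa using hk
    exact (Complex.continuous_conj.continuousAt.comp h2).mul (by fun_prop)
  obtain ⟨δ, hδ, h⟩ := Metric.continuousAt_iff.1 hH η hη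
  refine ⟨δ, hδ, fun ε h0 hε ξ hξ => ?_⟩
  -- Only the right limit of the symbol at 0 enters, so its jump there does no harm.
  have hpos : 0 < ξ + ε := by linarith [hξ.1]
  have h3 := h (x := (ξ + ε, ξ)) (by
    rw [Prod.dist_eq, max_lt_iff]
    simp only [Real.dist_eq, sub_zero]
    rw [abs_of_pos hpos, abs_of_nonpos hξ.2]
    constructor <;> linarith [hξ.1, hξ.2])
  rw [dist_eq_norm] at h3
  refine le_of_eq_of_le ?_ h3.le
  simp only [H, symbolPos, chiPos_of_pos hpos]
  congr 2
  · rw [div_mul_eq_mul_div, one_mul]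
  · simp

/-- The trace identity for `(1/i) φ' - C₊(u φ) = k φ` on the Fourier side. -/
theorem norm_integral_sq_eq (hk : k ≠ 0) (hf : Integrable fun x => (u x : ℂ) * φ x)
    (hf2 : MemLp (fun x => (u x : ℂ) * φ x) 2) (h : IsFourierPair φ ψ)
    (hψ : ∀ᵐ ξ : ℝ, (2 * Real.pi * ξ - (k : ℂ)) * ψ ξ =
      chiPos ξ * 𝓕 (fun x => (u x : ℂ) * φ x) ξ) :
    ‖∫ x : ℝ, (u x : ℂ) * φ x‖ ^ 2 = -2 * Real.pi * k * ∫ x : ℝ, ‖φ x‖ ^ 2 := by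
  set F := 𝓕 (fun x => (u x : ℂ) * φ x) with hFdef
  -- This representative of ψ vanishes for every ξ ≤ 0 and has a right limit at 0. Its square
  -- integrability comes from ψ, so a zero of 2πξ - k on the positive half line is harmless.
  set g : ℝ → ℂ := fun ξ => symbolPos k ξ * F ξ with hg
  have hgp : IsFourierPair φ g := h.congr EventuallyEq.rfl (ae_eq_symbolPos_mul hψ)
  have hF2 : MemLp F 2 := (IsFourierPair.of_integrable hf hf2).memLp_right
  have hFc : Continuous F := continuous_fourier hf
  have hg2 : MemLp g 2 := hgp.memLp_right
  have hFmul : ∀ᵐ ξ : ℝ, chiPos ξ * F ξ = (2 * Real.pi * ξ - (k : ℂ)) * g ξ := by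
    filter_upwards [ae_two_pi_mul_ne k] with ξ hξ
    simp only [g, symbolPos]
    field_simp
  have hmp : ∀ ε : ℝ, MeasurePreserving (fun ξ : ℝ => ξ + ε) volume volume :=
    fun ε => measurePreserving_add_right volume ε
  have hgs : ∀ ε : ℝ, MemLp (fun ξ => (starRingEnd ℂ) (g (ξ + ε))) 2 := fun ε =>
    (hg2.comp_measurePreserving (hmp ε)).star
  have hFs : ∀ ε : ℝ, MemLp (fun ξ => (starRingEnd ℂ) (F (ξ + ε))) 2 := fun ε =>
    (hF2.comp_measurePreserving (hmp ε)).star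
  have hchiF : MemLp (fun ξ => (1 - chiPos ξ) * F ξ) 2 := by
    refine hF2.of_le ((measurable_const.sub measurable_chiPos).aestronglyMeasurable.mul hF2.1)
      (ae_of_all _ fun ξ => ?_)
    rcases le_or_gt ξ 0 with h0 | h0
    · simp [chiPos_of_nonpos h0]
    · simp [chiPos_of_pos h0]
  have step : ∀ ε : ℝ, 0 < ε →
      ∫ ξ in Set.Ioc (-ε) 0, (starRingEnd ℂ) (g (ξ + ε)) * F ξ =
        2 * Real.pi * ε * ∫ ξ, (starRingEnd ℂ) (g (ξ + ε)) * g ξ := by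
    intro ε hε
    have h1 := integral_conj_mul_translate_comm hf hf2 hgp ε
    rw [← hFdef, ← integral_add_right_eq_self _ ε] at h1
    simp only [add_sub_cancel_right] at h1
    have i1 : Integrable (fun ξ => (starRingEnd ℂ) (g (ξ + ε)) * F ξ) :=
      integrable_mul_of_memLp_two (hgs ε) hF2
    have i2 : Integrable (fun ξ => g ξ * (starRingEnd ℂ) (F (ξ + ε))) :=
      integrable_mul_of_memLp_two hg2 (hFs ε)
    have i3 : Integrable (fun ξ => (starRingEnd ℂ) (g (ξ + ε)) * ((1 - chiPos ξ) * F ξ)) :=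
      integrable_mul_of_memLp_two (hgs ε) hchiF
    have i4 : Integrable (fun ξ => (starRingEnd ℂ) (g (ξ + ε)) * g ξ) :=
      integrable_mul_of_memLp_two (hgs ε) hg2
    -- Both copies of F are replaced through the equation. The real numbers 2πξ - k and 2π(ξ + ε) -
    -- k differ by 2πε, so k drops out. The equation does not determine F on the nonpositive half
    -- line, which leaves the term with 1 - χ.
    have h2 : ∀ᵐ ξ : ℝ, (starRingEnd ℂ) (g (ξ + ε)) * F ξ - g ξ * (starRingEnd ℂ) (F (ξ + ε)) =
        (starRingEnd ℂ) (g (ξ + ε)) * ((1 - chiPos ξ) * F ξ) -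
          2 * Real.pi * ε * ((starRingEnd ℂ) (g (ξ + ε)) * g ξ) := by
      filter_upwards [hFmul, (hmp ε).quasiMeasurePreserving.ae hFmul] with ξ e1 e2
      have e3 : F ξ = (2 * Real.pi * ξ - (k : ℂ)) * g ξ + (1 - chiPos ξ) * F ξ := by
        rw [← e1]; ring
      rcases le_or_gt ξ 0 with h0 | h0
      · have hg0 : g ξ = 0 := by simp [g, symbolPos, chiPos_of_nonpos h0]
        rw [hg0, chiPos_of_nonpos h0]
        ring
      · rw [chiPos_of_pos (by linarith), one_mul] at e2
        rw [e2, map_mul (starRingEnd ℂ) (2 * Real.pi * ((ξ + ε : ℝ) : ℂ) - k) (g (ξ + ε)),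
          conj_ofReal_mul_ofReal_sub]
        nth_rewrite 1 [e3]
        push_cast
        ring
    have h3 := integral_congr_ae h2
    rw [integral_sub i1 i2, h1, sub_self, integral_sub i3 (i4.const_mul _),
      integral_const_mul] at h3
    -- The factor 1 - χ requires ξ ≤ 0, and g(ξ + ε) ≠ 0 requires ξ > -ε.
    have h4 : ∫ ξ, (starRingEnd ℂ) (g (ξ + ε)) * ((1 - chiPos ξ) * F ξ) =
        ∫ ξ in Set.Ioc (-ε) 0, (starRingEnd ℂ) (g (ξ + ε)) * F ξ := by
      rw [← integral_indicator measurableSet_Ioc]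
      congr with ξ
      by_cases hξ : ξ ∈ Set.Ioc (-ε) 0
      · rw [Set.indicator_of_mem hξ, chiPos_of_nonpos hξ.2]
        ring
      · rw [Set.indicator_of_notMem hξ]
        rcases le_or_gt ξ 0 with h0 | h0
        · have : ξ + ε ≤ 0 := by
            by_contra! hc
            exact hξ ⟨by linarith, h0⟩
          have hg0 : g (ξ + ε) = 0 := by simp [g, symbolPos, chiPos_of_nonpos this]
          simp [hg0]
        · simp [chiPos_of_pos h0]
    rw [← h4]
    exact (sub_eq_zero.1 h3.symm)
  have lim1 := tendsto_average_of_near (H := fun ξ ε => (starRingEnd ℂ) (g (ξ + ε)) * F ξ)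
    (fun η hη => continuousAt_conj_mul_div hFc hk hη)
    (fun ε _ => (integrable_mul_of_memLp_two (hgs ε) hF2).integrableOn)
  have lim2 : Tendsto (fun ε : ℝ => 2 * Real.pi * ∫ ξ, (starRingEnd ℂ) (g (ξ + ε)) * g ξ)
      (𝓝[>] 0) (𝓝 (2 * Real.pi * ∫ ξ, (starRingEnd ℂ) (g ξ) * g ξ)) :=
    ((tendsto_integral_conj_translate_mul hg2).mono_left nhdsWithin_le_nhds).const_mul _
  have hlim := tendsto_nhds_unique (lim1.congr' (by
    filter_upwards [self_mem_nhdsWithin] with ε hε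
    have hε0 : (ε : ℂ) ≠ 0 := by
      have : (0 : ℝ) < ε := hε
      exact_mod_cast this.ne'
    rw [step ε hε]
    field_simp)) lim2
  rw [integral_conj_mul_self, ← hgp.integral_norm_sq] at hlim
  have hF0 : F 0 = ∫ x, (u x : ℂ) * φ x := fourier_zero _
  rw [← hF0]
  have hkc : (k : ℂ) ≠ 0 := by exact_mod_cast hk
  have h5 : ((‖F 0‖ ^ 2 : ℝ) : ℂ) = (starRingEnd ℂ) (F 0) * F 0 := by
    rw [mul_comm, Complex.mul_conj, Complex.normSq_eq_norm_sq]
  have h6 : (starRingEnd ℂ) (F 0 / (-k)) * F 0 = ((‖F 0‖ ^ 2 : ℝ) : ℂ) / (-k) := by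
    rw [h5]
    simp
    ring
  rw [h6, div_eq_iff (neg_ne_zero.2 hkc)] at hlim
  have h7 : ‖F 0‖ ^ 2 = 2 * Real.pi * (∫ x, ‖φ x‖ ^ 2) * -k := by exact_mod_cast hlim
  rw [h7]
  ring

end

/-! ### The operator `opL` on the Fourier side, and nonreal k -/

theorem IsFourierPair.fourier_ae_eq {φ ψ : ℝ → ℂ} (h : IsFourierPair φ ψ) {Φ : L2}
    (hΦ : Φ =ᵐ[volume] φ) : (𝓕 Φ : L2) =ᵐ[volume] ψ := by
  obtain ⟨Ψ, h1, h2⟩ := h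
  have : Φ = Ψ := Lp.ext (hΦ.trans h1.symm)
  rwa [this]

theorem eq_of_fourier_ae_eq {Φ Ψ : L2} (h : (𝓕 Φ : L2) =ᵐ[volume] (𝓕 Ψ : L2)) : Φ = Ψ :=
  (Lp.fourierTransformₗᵢ ℝ ℂ).injective (Lp.ext h)

theorem fourier_L2_sub (Φ Ψ : L2) : 𝓕 (Φ - Ψ) = 𝓕 Φ - 𝓕 Ψ :=
  (Lp.fourierTransformₗᵢ ℝ ℂ).map_sub Φ Ψ

theorem fourier_L2_smul (c : ℂ) (Φ : L2) : 𝓕 (c • Φ) = c • 𝓕 Φ :=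
  (Lp.fourierTransformₗᵢ ℝ ℂ).map_smul c Φ

theorem chiPos_mul_self (ξ : ℝ) : chiPos ξ * chiPos ξ = chiPos ξ := by
  rcases le_or_gt ξ 0 with h | h
  · simp [chiPos_of_nonpos h]
  · simp [chiPos_of_pos h]

theorem cauchyPlus_eq_self_of_fourier {Φ : L2}
    (h : ∀ᵐ ξ : ℝ, chiPos ξ * (𝓕 Φ : L2) ξ = (𝓕 Φ : L2) ξ) : cauchyPlus Φ = Φ := by
  refine eq_of_fourier_ae_eq ?_
  filter_upwards [fourier_cauchyPlus Φ, h] with ξ h1 h2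
  rw [h1, h2]

theorem cauchyPlus_of_mem_hardy {Φ : L2} (h : Φ ∈ hardy) : cauchyPlus Φ = Φ := by
  obtain ⟨g, rfl⟩ := h
  refine cauchyPlus_eq_self_of_fourier ?_
  filter_upwards [fourier_cauchyPlus g] with ξ h1
  rw [h1, ← mul_assoc, chiPos_mul_self]

theorem fourier_opL {u : ℝ → ℝ} (φ : (opL u).domain) {f : ℝ → ℂ} (hf : Integrable f)
    (hf2 : MemLp f 2) (h : (fun x => (u x : ℂ) * ((φ : hardy) : L2) x) =ᵐ[volume] f) :
    (𝓕 ((opL u φ : hardy) : L2) : L2) =ᵐ[volume] fun ξ =>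
      (2 * Real.pi * ξ : ℂ) * (𝓕 ((φ : hardy) : L2) : L2) ξ - chiPos ξ * 𝓕 f ξ := by
  have e : ((opL u φ : hardy) : L2) = momentum ⟨((φ : hardy) : L2), φ.2.1⟩ -
      cauchyPlus (mulOp (fun x => (u x : ℂ)) ⟨cauchyPlus ((φ : hardy) : L2), φ.2.2⟩) := rfl
  rw [e, fourier_L2_sub]
  have h1 := coeFn_mulOp (fun x => (u x : ℂ)) ⟨cauchyPlus ((φ : hardy) : L2), φ.2.2⟩
  simp only [cauchyPlus_of_mem_hardy (φ : hardy).2] at h1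
  have h2 := (IsFourierPair.of_integrable hf hf2).fourier_ae_eq (h1.trans h)
  have h3 : (𝓕 (momentum ⟨((φ : hardy) : L2), φ.2.1⟩) : L2) =ᵐ[volume] _ :=
    fourier_fourierMul _ _
  have h4 := fourier_cauchyPlus
    (mulOp (fun x => (u x : ℂ)) ⟨cauchyPlus ((φ : hardy) : L2), φ.2.2⟩)
  simp only [cauchyPlus_of_mem_hardy (φ : hardy).2] at h3 h4 ⊢
  have hd : cauchyPlus ((φ : hardy) : L2) ∈ (mulOp fun x => (u x : ℂ)).domain := φ.2.2
  rw [cauchyPlus_of_mem_hardy (φ : hardy).2] at hd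
  filter_upwards [Lp.coeFn_sub (𝓕 (momentum ⟨((φ : hardy) : L2), φ.2.1⟩))
    (𝓕 (cauchyPlus (mulOp (fun x => (u x : ℂ)) ⟨(φ : hardy), hd⟩))), h2, h3, h4]
    with ξ a1 a2 a3 a4
  rw [a1, Pi.sub_apply, a3, a4, a2]
  push_cast
  rfl

section

variable {u : ℝ → ℝ} {φ ψ : ℝ → ℂ} {k : ℂ}

/-- The Fourier equation places φ in the domain of `opL u` with L_u φ = kφ, and the left inverse of
L_u - k then kills φ. -/
theorem ae_eq_zero_of_mem_resolventSet (hk : k ∈ resolventSet (opL u))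
    (hf : Integrable fun x => (u x : ℂ) * φ x)
    (hf2 : MemLp (fun x => (u x : ℂ) * φ x) 2) (h : IsFourierPair φ ψ)
    (hψ : ∀ᵐ ξ : ℝ, (2 * Real.pi * ξ - k : ℂ) * ψ ξ =
      chiPos ξ * 𝓕 (fun x => (u x : ℂ) * φ x) ξ) :
    φ =ᵐ[volume] 0 := by
  have hF2 := (IsFourierPair.of_integrable hf hf2).memLp_right
  have hψ2 := h.memLp_right
  have hsym := ae_eq_symbolPos_mul hψ
  obtain ⟨Φ, h1, h2⟩ := h
  have hC : cauchyPlus Φ = Φ := by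
    refine cauchyPlus_eq_self_of_fourier ?_
    filter_upwards [h2, hsym] with ξ e1 e2
    rw [e1, e2, symbolPos, ← mul_assoc, ← mul_div_assoc, chiPos_mul_self]
  have hH : Φ ∈ hardy := ⟨Φ, hC⟩
  have hm : Φ ∈ momentum.domain := by
    change MemLp (fun ξ : ℝ => ((2 * Real.pi * ξ : ℝ) : ℂ) * (𝓕 Φ : L2) ξ) 2 volume
    have hchi : MemLp (fun ξ => chiPos ξ * 𝓕 (fun x => (u x : ℂ) * φ x) ξ) 2 := by
      refine hF2.of_le (measurable_chiPos.aestronglyMeasurable.mul hF2.1)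
        (ae_of_all _ fun ξ => ?_)
      rcases le_or_gt ξ 0 with h0 | h0
      · simp [chiPos_of_nonpos h0]
      · simp [chiPos_of_pos h0]
    refine ((hψ2.const_mul k).add hchi).ae_eq ?_
    filter_upwards [h2, hψ] with ξ e1 e2
    rw [Pi.add_apply, e1, ← e2]
    push_cast
    ring
  have hu : (fun x => (u x : ℂ) * Φ x) =ᵐ[volume] fun x => (u x : ℂ) * φ x := by
    filter_upwards [h1] with x e1
    rw [e1]
  have hd : (⟨Φ, hH⟩ : hardy) ∈ (opL u).domain := by
    refine ⟨hm, ?_⟩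
    change MemLp (fun x => (u x : ℂ) * (cauchyPlus Φ) x) 2 volume
    rw [hC]
    exact hf2.ae_eq hu.symm
  have hL : opL u ⟨⟨Φ, hH⟩, hd⟩ = k • (⟨Φ, hH⟩ : hardy) := by
    ext1
    refine eq_of_fourier_ae_eq ?_
    rw [Submodule.coe_smul, fourier_L2_smul]
    filter_upwards [fourier_opL ⟨⟨Φ, hH⟩, hd⟩ hf hf2 hu, h2, hψ, Lp.coeFn_smul k (𝓕 Φ)]
      with ξ e1 e2 e3 e4
    rw [e1, e4, Pi.smul_apply, smul_eq_mul, e2, ← e3]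
    ring
  obtain ⟨R, -, hR⟩ := hk
  have h3 := hR ⟨⟨Φ, hH⟩, hd⟩
  rw [hL, sub_self, map_zero] at h3
  have h4 : Φ = 0 := (congrArg (fun z : hardy => (z : L2)) h3).symm
  rw [h4] at h1
  exact h1.symm.trans (Lp.coeFn_zero _ _ _)

theorem ae_eq_zero_of_norm_integral_sq_eq {l : ℝ} (hl : 0 < l) (hφ : MemLp φ 2)
    (h : ‖∫ x : ℝ, (u x : ℂ) * φ x‖ ^ 2 = -2 * Real.pi * l * ∫ x : ℝ, ‖φ x‖ ^ 2) :
    φ =ᵐ[volume] 0 := by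
  refine ae_eq_zero_of_integral_norm_sq hφ (le_antisymm ?_ (integral_nonneg fun x => by positivity))
  have h1 : 0 ≤ -2 * Real.pi * l * ∫ x : ℝ, ‖φ x‖ ^ 2 := h ▸ by positivity
  have h2 : 0 < 2 * Real.pi * l := by positivity
  by_contra! h3
  nlinarith [mul_pos h2 h3]

/-- An eigenfunction satisfies the hypotheses of the trace identity directly, and for l > 0 its two
sides have opposite signs. -/
theorem not_isEigenvalue_opL (hu : MemLp u 2) {l : ℝ} (hl : 0 < l) :
    ¬ IsEigenvalue (opL u) (l : ℂ) := by
  rintro ⟨φ, hφ, he⟩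
  have huc : MemLp (fun x => (u x : ℂ)) 2 := hu.ofReal
  have hf : Integrable fun x => (u x : ℂ) * ((φ : hardy) : L2) x :=
    integrable_mul_of_memLp_two huc (Lp.memLp _)
  have hf2 : MemLp (fun x => (u x : ℂ) * ((φ : hardy) : L2) x) 2 := by
    have : MemLp (fun x => (u x : ℂ) * (cauchyPlus ((φ : hardy) : L2)) x) 2 volume := φ.2.2
    rwa [cauchyPlus_of_mem_hardy (φ : hardy).2] at this
  have hp : IsFourierPair ((φ : hardy) : L2) (𝓕 ((φ : hardy) : L2) : L2) :=
    ⟨_, EventuallyEq.rfl, EventuallyEq.rfl⟩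
  have h1 := fourier_opL φ hf hf2 EventuallyEq.rfl
  rw [he, Submodule.coe_smul, fourier_L2_smul] at h1
  have h2 := norm_integral_sq_eq hl.ne' hf hf2 hp (by
    filter_upwards [h1, Lp.coeFn_smul (l : ℂ) (𝓕 ((φ : hardy) : L2))] with ξ e1 e2
    rw [e2, Pi.smul_apply, smul_eq_mul] at e1
    rw [sub_mul, e1]
    ring)
  have h3 := ae_eq_zero_of_norm_integral_sq_eq hl (Lp.memLp _) h2
  apply hφ
  ext1
  ext1
  exact Lp.eq_zero_iff_ae_eq_zero.2 h3

theorem im_integral_conj_mul_potential (φ : ℝ → ℂ) (u : ℝ → ℝ) :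
    (∫ x, (starRingEnd ℂ) (φ x) * ((u x : ℂ) * φ x)).im = 0 := by
  have : ∀ x, (starRingEnd ℂ) (φ x) * ((u x : ℂ) * φ x) = ((u x * ‖φ x‖ ^ 2 : ℝ) : ℂ) := by
    intro x
    have : (starRingEnd ℂ) (φ x) * φ x = ((‖φ x‖ ^ 2 : ℝ) : ℂ) := by
      rw [mul_comm, Complex.mul_conj, Complex.normSq_eq_norm_sq]
    rw [Complex.ofReal_mul, ← this]
    ring
  simp_rw [this]
  rw [integral_complex_ofReal, Complex.ofReal_im]

/-- By Parseval the real number ⟨φ, uφ⟩ is the integral of (2πξ - k)|φ̂|², whose imaginary part is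
-Im k ‖φ‖². -/
theorem ae_eq_zero_of_im_ne_zero (hk : k.im ≠ 0)
    (hf : Integrable fun x => (u x : ℂ) * φ x)
    (hf2 : MemLp (fun x => (u x : ℂ) * φ x) 2)
    (h : IsFourierPair φ fun ξ => symbolPos k ξ * 𝓕 (fun x => (u x : ℂ) * φ x) ξ) :
    φ =ᵐ[volume] 0 := by
  set F := 𝓕 (fun x => (u x : ℂ) * φ x)
  have hFp : IsFourierPair (fun x => (u x : ℂ) * φ x) F := IsFourierPair.of_integrable hf hf2
  have h1 := congrArg Complex.im (h.integral_conj_mul hFp)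
  rw [im_integral_conj_mul_potential] at h1
  have hi : Integrable fun ξ => (starRingEnd ℂ) (symbolPos k ξ * F ξ) * F ξ :=
    integrable_mul_of_memLp_two h.memLp_right.star hFp.memLp_right
  have h2 : ∀ ξ : ℝ, ((starRingEnd ℂ) (symbolPos k ξ * F ξ) * F ξ).im =
      -k.im * ‖symbolPos k ξ * F ξ‖ ^ 2 := by
    intro ξ
    rcases le_or_gt ξ 0 with h0 | h0
    · simp [symbolPos, chiPos_of_nonpos h0]
    · have hne : (2 * Real.pi * ξ - k : ℂ) ≠ 0 := by
        intro h0
        apply hk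
        simpa using congrArg Complex.im h0
      have e : F ξ = (2 * Real.pi * ξ - k : ℂ) * (symbolPos k ξ * F ξ) := by
        rw [symbolPos, chiPos_of_pos h0]
        field_simp
      nth_rewrite 2 [e]
      generalize symbolPos k ξ * F ξ = z
      have : (starRingEnd ℂ) z * ((2 * Real.pi * ξ - k : ℂ) * z) =
          (2 * Real.pi * ξ - k : ℂ) * ((‖z‖ ^ 2 : ℝ) : ℂ) := by
        rw [← Complex.normSq_eq_norm_sq, ← Complex.mul_conj]
        ring
      rw [this, Complex.im_mul_ofReal]
      simp
  have h3 : (∫ ξ, (starRingEnd ℂ) (symbolPos k ξ * F ξ) * F ξ).im =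
      ∫ ξ, ((starRingEnd ℂ) (symbolPos k ξ * F ξ) * F ξ).im := (integral_im hi).symm
  rw [h3] at h1
  simp_rw [h2] at h1
  rw [integral_const_mul, ← h.integral_norm_sq] at h1
  refine ae_eq_zero_of_integral_norm_sq h.memLp_left ?_
  rcases mul_eq_zero.1 h1.symm with h4 | h4
  · exact absurd (neg_eq_zero.1 h4) hk
  · exact h4

theorem isFourierPair_of_eq_opT_off (hk : k ∉ ((↑) : ℝ → ℂ) '' Set.Ici 0)
    (hf : Integrable fun x => (u x : ℂ) * φ x) (hf2 : MemLp (fun x => (u x : ℂ) * φ x) 2)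
    (h : φ =ᵐ[volume] opT u (.off k hk) φ) :
    IsFourierPair φ fun ξ => symbolPos k ξ * 𝓕 (fun x => (u x : ℂ) * φ x) ξ := by
  obtain ⟨M, hM⟩ := exists_bound_of_norm_le (exists_norm_symbolPos_le hk)
  exact (isFourierPair_convolution (memLp_symbolPos hk) hM (isFourierPair_kernelPos hk)
    hf hf2).congr h.symm EventuallyEq.rfl

theorem two_pi_mul_sub_mul_symbolPos {k : ℂ} (F : ℝ → ℂ) :
    ∀ᵐ ξ : ℝ, (2 * Real.pi * ξ - k : ℂ) * (symbolPos k ξ * F ξ) = chiPos ξ * F ξ := by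
  filter_upwards [ae_two_pi_mul_ne k] with ξ hξ
  rw [symbolPos]
  field_simp

end

/-! ### The retarded integral -/

/-- `e^{-iλy} f(y)`. -/
noncomputable def demodulate (l : ℝ) (f : ℝ → ℂ) (y : ℝ) : ℂ :=
  Complex.exp (-(Complex.I * l * y)) * f y

/-- The solution `i ∫_{-∞}^x e^{iλ(x-y)} f(y) dy` of `(1/i) A' - λ A = f` vanishing at `-∞`. -/
noncomputable def retarded (l : ℝ) (f : ℝ → ℂ) (x : ℝ) : ℂ :=
  Complex.I * Complex.exp (Complex.I * l * x) * ∫ y in Set.Iio x, demodulate l f y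

theorem norm_exp_neg_I_mul (l y : ℝ) : ‖Complex.exp (-(Complex.I * l * y))‖ = 1 := by
  have := norm_exp_I_mul l (-y)
  simpa using this

theorem norm_demodulate (l : ℝ) (f : ℝ → ℂ) (y : ℝ) : ‖demodulate l f y‖ = ‖f y‖ := by
  rw [demodulate, norm_mul, norm_exp_neg_I_mul, one_mul]

theorem norm_retarded (l : ℝ) (f : ℝ → ℂ) (x : ℝ) :
    ‖retarded l f x‖ = ‖∫ y in Set.Iio x, demodulate l f y‖ := by
  rw [retarded, norm_mul, norm_mul, Complex.norm_I, norm_exp_I_mul, one_mul, one_mul]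

section

variable {f : ℝ → ℂ} (l : ℝ)

theorem integrable_demodulate (hf : Integrable f) : Integrable (demodulate l f) := by
  refine (integrable_norm_iff ?_).1 (by simpa only [norm_demodulate] using hf.norm)
  exact (Continuous.aestronglyMeasurable (by fun_prop)).mul hf.1

theorem continuous_integral_Iio {h : ℝ → ℂ} (hh : Integrable h) :
    Continuous fun x => ∫ y in Set.Iio x, h y := by
  have h1 : (fun x => ∫ y in Set.Iio x, h y) =
      fun x => (∫ y in (0 : ℝ)..x, h y) + ∫ y in Set.Iic 0, h y := by
    ext x
    rw [← intervalIntegral.integral_Iic_sub_Iic hh.integrableOn hh.integrableOn,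
      sub_add_cancel, integral_Iic_eq_integral_Iio]
  rw [h1]
  exact (intervalIntegral.continuous_primitive (fun a b => hh.intervalIntegrable) 0).add
    continuous_const

theorem continuous_retarded (hf : Integrable f) : Continuous (retarded l f) :=
  Continuous.mul (by fun_prop) (continuous_integral_Iio (integrable_demodulate l hf))

theorem integral_Ioi_eq_sub {h : ℝ → ℂ} (hh : Integrable h) (x : ℝ) :
    ∫ y in Set.Ioi x, h y = (∫ y, h y) - ∫ y in Set.Iio x, h y := by
  rw [← intervalIntegral.integral_Iic_add_Ioi (b := x) hh.integrableOn hh.integrableOn,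
    integral_Iic_eq_integral_Iio]
  ring

/-- The integrated form of (|H|²)' = 2 Re(conj H · h) for the primitive H of h from -∞. It is
obtained without differentiating: splitting ∫h at x gives |∫h|² - J, and Fubini on {x < y} shows
that this is conj J. -/
theorem two_mul_re_integral_conj_primitive_mul {h : ℝ → ℂ} (hh : Integrable h) :
    2 * (∫ x, (starRingEnd ℂ) (∫ y in Set.Iio x, h y) * h x).re = ‖∫ x, h x‖ ^ 2 := by
  set J := ∫ x, (starRingEnd ℂ) (∫ y in Set.Iio x, h y) * h x with hJ
  have hbd : ∀ x, ‖(starRingEnd ℂ) (∫ y in Set.Iio x, h y)‖ ≤ ∫ y, ‖h y‖ := by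
    intro x
    rw [RCLike.norm_conj]
    exact (norm_integral_le_integral_norm _).trans
      (setIntegral_le_integral hh.norm (ae_of_all _ fun _ => norm_nonneg _))
  have hi : Integrable fun x => (starRingEnd ℂ) (∫ y in Set.Iio x, h y) * h x :=
    hh.bdd_mul (Complex.continuous_conj.comp (continuous_integral_Iio hh)).aestronglyMeasurable
      (ae_of_all _ hbd)
  have h1 : ∫ x, (starRingEnd ℂ) (∫ y in Set.Ioi x, h y) * h x =
      ((‖∫ x, h x‖ ^ 2 : ℝ) : ℂ) - J := by
    simp_rw [integral_Ioi_eq_sub hh, map_sub, sub_mul]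
    rw [integral_sub (hh.const_mul _) hi, integral_const_mul, mul_comm, Complex.mul_conj,
      Complex.normSq_eq_norm_sq]
  have h2 : ∫ x, (starRingEnd ℂ) (∫ y in Set.Ioi x, h y) * h x = (starRingEnd ℂ) J := by
    let K : ℝ × ℝ → ℂ := {p : ℝ × ℝ | p.1 < p.2}.indicator
      (fun p => h p.1 * (starRingEnd ℂ) (h p.2))
    have hK : Integrable K (volume.prod volume) :=
      (hh.mul_prod (Complex.conjCLE.toContinuousLinearMap.integrable_comp hh)).indicator
        (measurableSet_lt measurable_fst measurable_snd)
    have h3 := integral_integral_swap (f := fun x y => K (x, y)) hK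
    have e1 : ∀ x, ∫ y, K (x, y) = (starRingEnd ℂ) (∫ y in Set.Ioi x, h y) * h x := by
      intro x
      rw [← integral_conj, mul_comm, ← integral_const_mul, ← integral_indicator measurableSet_Ioi]
      congr with y
    have e2 : ∀ y, ∫ x, K (x, y) =
        (starRingEnd ℂ) ((starRingEnd ℂ) (∫ x in Set.Iio y, h x) * h y) := by
      intro y
      rw [map_mul, Complex.conj_conj, ← integral_mul_const, ← integral_indicator measurableSet_Iio]
      congr with x
    simp_rw [e1, e2] at h3
    rw [h3, integral_conj]
  have h4 := congrArg Complex.re (h1.symm.trans h2)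
  rw [Complex.sub_re, Complex.ofReal_re, Complex.conj_re] at h4
  linarith

theorem integral_conj_retarded_mul_im (hf : Integrable f) :
    2 * (∫ x, (starRingEnd ℂ) (retarded l f x) * f x).im = -‖∫ x, demodulate l f x‖ ^ 2 := by
  rw [← two_mul_re_integral_conj_primitive_mul (integrable_demodulate l hf)]
  have h1 : ∀ x, (starRingEnd ℂ) (retarded l f x) * f x = -Complex.I *
      ((starRingEnd ℂ) (∫ y in Set.Iio x, demodulate l f y) * demodulate l f x) := by
    intro x
    rw [retarded, map_mul, map_mul, Complex.conj_I, ← Complex.exp_conj, demodulate]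
    have : (starRingEnd ℂ) (Complex.I * l * x) = -(Complex.I * l * x) := by
      rw [map_mul, map_mul, Complex.conj_I, Complex.conj_ofReal, Complex.conj_ofReal]
      ring
    rw [this]
    ring
  simp_rw [h1]
  rw [integral_const_mul]
  simp

theorem norm_retarded_le (hf : Integrable f) (x : ℝ) : ‖retarded l f x‖ ≤ ∫ y, ‖f y‖ := by
  rw [norm_retarded]
  refine (norm_integral_le_integral_norm _).trans ?_
  simp_rw [norm_demodulate]
  exact setIntegral_le_integral hf.norm (ae_of_all _ fun _ => norm_nonneg _)

/-- The vanishing mean lets the integral over (-∞, x) be traded for minus the one over (x, ∞) when x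
> 0. On the chosen side |y| ≥ |x|, so the weight moves under the integral. -/
theorem rpow_mul_norm_retarded_le (hf : Integrable f) (h0 : ∫ x, demodulate l f x = 0) {b : ℝ}
    (hb : 0 ≤ b) (hbf : Integrable fun x : ℝ => (1 + |x|) ^ b * ‖f x‖) (x : ℝ) :
    (1 + |x|) ^ b * ‖retarded l f x‖ ≤ ∫ y : ℝ, (1 + |y|) ^ b * ‖f y‖ := by
  have key : ∀ S : Set ℝ, MeasurableSet S → (∀ y ∈ S, |x| ≤ |y|) →
      (1 + |x|) ^ b * ‖∫ y in S, demodulate l f y‖ ≤ ∫ y : ℝ, (1 + |y|) ^ b * ‖f y‖ := by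
    intro S hS hxy
    calc (1 + |x|) ^ b * ‖∫ y in S, demodulate l f y‖
        ≤ (1 + |x|) ^ b * ∫ y in S, ‖f y‖ := by
          gcongr
          refine (norm_integral_le_integral_norm _).trans_eq ?_
          simp_rw [norm_demodulate]
      _ = ∫ y in S, (1 + |x|) ^ b * ‖f y‖ := (integral_const_mul _ _).symm
      _ ≤ ∫ y in S, (1 + |y|) ^ b * ‖f y‖ := by
          refine setIntegral_mono_on (hf.norm.const_mul _).integrableOn hbf.integrableOn hS ?_
          intro y hy
          have := hxy y hy
          gcongr
      _ ≤ _ := setIntegral_le_integral hbf (ae_of_all _ fun y => by positivity)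
  rw [norm_retarded]
  rcases le_or_gt x 0 with hx | hx
  · refine key _ measurableSet_Iio fun y hy => ?_
    have hy' : y < x := hy
    rw [abs_of_nonpos hx, abs_of_neg (by linarith)]
    linarith
  · have := integral_Ioi_eq_sub (integrable_demodulate l hf) x
    rw [h0, zero_sub] at this
    rw [← norm_neg, ← this]
    refine key _ measurableSet_Ioi fun y hy => ?_
    have hy' : x < y := hy
    rw [abs_of_pos hx, abs_of_pos (by linarith)]
    exact hy'.le

/-- The kernel `i e^{iλz}` on `(-t, 0]`, which is the increment over `t` of the retarded kernel. -/
noncomputable def incrementKernel (t : ℝ) : ℝ → ℂ :=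
  (Set.Ioc (-t) 0).indicator fun z : ℝ => Complex.I * Complex.exp (Complex.I * l * z)

theorem integrable_incrementKernel (t : ℝ) : Integrable (incrementKernel l t) := by
  rw [incrementKernel, integrable_indicator_iff measurableSet_Ioc]
  exact (Continuous.continuousOn (by fun_prop)).integrableOn_Icc.mono_set Set.Ioc_subset_Icc_self

theorem fourier_incrementKernel {t ξ : ℝ} (ht : 0 ≤ t)
    (hξ : Complex.I * l - 2 * Real.pi * Complex.I * ξ ≠ 0) :
    𝓕 (incrementKernel l t) ξ = Complex.I *
      (1 - Complex.exp (-((Complex.I * l - 2 * Real.pi * Complex.I * ξ) * t))) /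
        (Complex.I * l - 2 * Real.pi * Complex.I * ξ) := by
  have h1 := integral_exp_mul_complex (a := -t) (b := 0) hξ
  rw [intervalIntegral.integral_of_le (by linarith), ← integral_indicator measurableSet_Ioc] at h1
  rw [mul_div_assoc]
  simp only [Complex.ofReal_zero, mul_zero, Complex.exp_zero, Complex.ofReal_neg, mul_neg] at h1
  rw [← h1, ← integral_const_mul, Real.fourier_eq']
  congr with z
  by_cases hz : z ∈ Set.Ioc (-t) 0
  · simp only [incrementKernel, hz, Set.indicator_of_mem, smul_eq_mul]
    rw [mul_left_comm, ← Complex.exp_add]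
    congr 2
    simp
    ring
  · simp [incrementKernel, hz]

theorem retarded_add_sub (hf : Integrable f) {t : ℝ} (ht : 0 ≤ t) (x : ℝ) :
    Complex.exp (-(Complex.I * l * t)) * retarded l f (x + t) - retarded l f x =
      convolution f (incrementKernel l t) (ContinuousLinearMap.mul ℂ ℂ) volume x := by
  have hh := integrable_demodulate l hf
  have h1 : (∫ y in Set.Iio (x + t), demodulate l f y) - ∫ y in Set.Iio x, demodulate l f y =
      ∫ y in Set.Ico x (x + t), demodulate l f y := by
    have := setIntegral_union (μ := volume) (f := demodulate l f) (s := Set.Iio x)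
      (t := Set.Ico x (x + t))
      (Set.disjoint_left.2 fun y hy hy' => not_le.2 hy hy'.1) measurableSet_Ico
      hh.integrableOn hh.integrableOn
    rw [Set.Iio_union_Ico_eq_Iio (by linarith)] at this
    rw [this]
    ring
  have h2 : Complex.exp (-(Complex.I * l * t)) * Complex.exp (Complex.I * l * (x + t : ℝ)) =
      Complex.exp (Complex.I * l * x) := by
    rw [← Complex.exp_add]
    congr 1
    push_cast
    ring
  have h3 : Complex.exp (-(Complex.I * l * t)) * retarded l f (x + t) - retarded l f x =
      Complex.I * Complex.exp (Complex.I * l * x) *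
        ∫ y in Set.Ico x (x + t), demodulate l f y := by
    rw [← h1, mul_sub, retarded, retarded, ← h2]
    ring
  rw [h3, convolution, ← integral_const_mul, ← integral_indicator measurableSet_Ico]
  congr with y
  have hiff : y ∈ Set.Ico x (x + t) ↔ x - y ∈ Set.Ioc (-t) 0 := by
    simp only [Set.mem_Ico, Set.mem_Ioc]
    constructor <;> rintro ⟨h1, h2⟩ <;> constructor <;> linarith
  by_cases hy : y ∈ Set.Ico x (x + t)
  · rw [Set.indicator_of_mem hy, ContinuousLinearMap.mul_apply', incrementKernel,
      Set.indicator_of_mem (hiff.1 hy), demodulate]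
    have : Complex.exp (Complex.I * l * (x - y : ℝ)) =
        Complex.exp (Complex.I * l * x) * Complex.exp (-(Complex.I * l * y)) := by
      rw [← Complex.exp_add]
      congr 1
      push_cast
      ring
    rw [this]
    ring
  · rw [Set.indicator_of_notMem hy, ContinuousLinearMap.mul_apply', incrementKernel,
      Set.indicator_of_notMem (fun h => hy (hiff.2 h)), mul_zero]

theorem fourier_comp_add_right (g : ℝ → ℂ) (t ξ : ℝ) :
    𝓕 (fun x => g (x + t)) ξ = Complex.exp (2 * Real.pi * Complex.I * ξ * t) * 𝓕 g ξ := by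
  have := congrFun (VectorFourier.fourierIntegral_comp_add_right Real.fourierChar volume
    (innerₗ ℝ) g t) ξ
  refine Eq.trans this ?_
  rw [Circle.smul_def, smul_eq_mul, Real.fourierChar_apply]
  congr 2
  simp
  ring

/-- The equation (1/i)A' - λA = f is used in finite-difference form: e^{-iλt}A(x + t) - A(x) is a
convolution of f with an integrable kernel. On the Fourier side this multiplies Â by e^{iθt} - 1,
where θ = 2πξ - λ. -/
theorem fourier_retarded (hf : Integrable f) (hA : Integrable (retarded l f)) {ξ : ℝ}
    (hξ : (2 * Real.pi * ξ - l : ℂ) ≠ 0) :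
    (2 * Real.pi * ξ - l : ℂ) * 𝓕 (retarded l f) ξ = 𝓕 f ξ := by
  set θ : ℝ := 2 * Real.pi * ξ - l with hθ
  have hθc : (2 * Real.pi * ξ - l : ℂ) = (θ : ℂ) := by rw [hθ]; push_cast; rfl
  have hθ0 : θ ≠ 0 := by
    rw [hθc] at hξ
    exact_mod_cast hξ
  -- A half period, so that e^{iθt} = -1 and the factor e^{iθt} - 1 = -2 can be divided out.
  set t : ℝ := Real.pi / |θ| with htdef
  have ht : 0 ≤ t := by positivity
  have hc : Complex.I * l - 2 * Real.pi * Complex.I * ξ = -(Complex.I * θ) := by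
    rw [← hθc]
    ring
  have hc0 : Complex.I * l - 2 * Real.pi * Complex.I * ξ ≠ 0 := by
    rw [hc]
    exact neg_ne_zero.2 (mul_ne_zero Complex.I_ne_zero (by exact_mod_cast hθ0))
  have hexp : Complex.exp (Complex.I * θ * t) = -1 := by
    rcases lt_or_gt_of_ne hθ0 with h | h
    · have : θ * t = -Real.pi := by
        rw [htdef, abs_of_neg h]
        field_simp
      have h2 : Complex.I * θ * t = -(Real.pi * Complex.I) := by
        rw [mul_assoc, ← Complex.ofReal_mul, this]
        push_cast
        ring
      rw [h2, Complex.exp_neg, Complex.exp_pi_mul_I]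
      norm_num
    · have : θ * t = Real.pi := by
        rw [htdef, abs_of_pos h]
        field_simp
      have h2 : Complex.I * θ * t = Real.pi * Complex.I := by
        rw [mul_assoc, ← Complex.ofReal_mul, this]
        ring
      rw [h2, Complex.exp_pi_mul_I]
  have h1 := Real.fourier_mul_convolution_eq hf (integrable_incrementKernel l t) ξ
  rw [fourier_incrementKernel l ht hc0, hc] at h1
  have h2 : 𝓕 (fun x => Complex.exp (-(Complex.I * l * t)) * retarded l f (x + t) -
      retarded l f x) ξ = Complex.exp (-(Complex.I * l * t)) *
        (Complex.exp (2 * Real.pi * Complex.I * ξ * t) * 𝓕 (retarded l f) ξ) -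
          𝓕 (retarded l f) ξ := by
    rw [← fourier_comp_add_right, Real.fourier_eq, Real.fourier_eq, Real.fourier_eq,
      ← integral_const_mul, ← integral_sub]
    · congr with x
      simp only [Circle.smul_def, smul_eq_mul]
      ring
    · exact ((Real.fourierIntegral_convergent_iff ξ).2 (hA.comp_add_right t)).const_mul _
    · exact (Real.fourierIntegral_convergent_iff ξ).2 hA
  have h3 : (fun x => Complex.exp (-(Complex.I * l * t)) * retarded l f (x + t) -
      retarded l f x) = convolution f (incrementKernel l t) (ContinuousLinearMap.mul ℂ ℂ) volume :=
    funext fun x => retarded_add_sub l hf ht x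
  rw [h3, h1, ← mul_assoc, ← Complex.exp_add] at h2
  have h4 : -(Complex.I * l * t) + 2 * Real.pi * Complex.I * ξ * t = Complex.I * θ * t := by
    rw [← hθc]
    ring
  rw [h4, hexp, show -(-(Complex.I * (θ : ℂ)) * (t : ℂ)) = Complex.I * θ * t by ring, hexp] at h2
  have hθC : (θ : ℂ) ≠ 0 := by exact_mod_cast hθ0
  rw [hθc]
  have h5 : Complex.I * (1 - -1) / -(Complex.I * (θ : ℂ)) = -2 / θ := by
    have := Complex.I_ne_zero
    field_simp
    norm_num
  rw [h5] at h2
  field_simp at h2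
  linear_combination (1 / 2 : ℂ) * h2

end

/-! ### Weights and decay rates -/

theorem continuous_one_add_abs_rpow (s : ℝ) : Continuous fun x : ℝ => (1 + |x|) ^ s :=
  Continuous.rpow_const (by fun_prop) fun x => Or.inl (by positivity)

theorem MemWeightedLp.aestronglyMeasurable {E : Type*} [NormedAddCommGroup E] [NormedSpace ℝ E]
    {f : ℝ → E} {p : ℝ≥0∞} {s : ℝ} (h : MemWeightedLp f p s) : AEStronglyMeasurable f := by
  refine ((continuous_one_add_abs_rpow (-s)).aestronglyMeasurable.smul h.1).congr
    (ae_of_all _ fun x => ?_)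
  have hx : 0 < 1 + |x| := by positivity
  change (1 + |x|) ^ (-s) • ((1 + |x|) ^ s • f x) = f x
  rw [smul_smul, ← Real.rpow_add hx, neg_add_cancel, Real.rpow_zero, one_smul]

/-- `φ(x) = O((1 + |x|)^{-a})` almost everywhere. -/
def DecayRate (φ : ℝ → ℂ) (a : ℝ) : Prop :=
  ∃ C : ℝ, ∀ᵐ x : ℝ, ‖φ x‖ ≤ C * (1 + |x|) ^ (-a)

theorem MemWeightedLp.decayRate {φ : ℝ → ℂ} {a : ℝ} (h : MemWeightedLp φ ⊤ a) :
    DecayRate φ a := by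
  refine ⟨(eLpNorm (fun x : ℝ => ((1 + |x|) ^ a : ℝ) • φ x) ⊤ volume).toReal, ?_⟩
  have h1 : ∀ᵐ x : ℝ, ‖((1 + |x|) ^ a : ℝ) • φ x‖ₑ ≤
      eLpNorm (fun x : ℝ => ((1 + |x|) ^ a : ℝ) • φ x) ⊤ volume := ae_le_eLpNormEssSup
  filter_upwards [h1] with x hx
  have h2 := ENNReal.toReal_mono h.2.ne hx
  have hx0 : 0 < 1 + |x| := by positivity
  rw [toReal_enorm, norm_smul, Real.norm_of_nonneg (by positivity)] at h2
  rw [Real.rpow_neg hx0.le, ← div_eq_mul_inv, le_div_iff₀ (by positivity), mul_comm]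
  exact h2

theorem norm_weight_mul (b x : ℝ) (z : ℂ) :
    ‖(1 + |x|) ^ b * ‖z‖‖ = (1 + |x|) ^ b * ‖z‖ :=
  Real.norm_of_nonneg (by positivity)

section

variable {u : ℝ → ℝ} {φ : ℝ → ℂ} {s a b : ℝ}

theorem memLp_weight_potential (hu : MemWeightedLp u 2 s) (hφm : AEStronglyMeasurable φ)
    (hφ : DecayRate φ a) (hb : b ≤ s + a) :
    MemLp (fun x : ℝ => (1 + |x|) ^ b * ‖(u x : ℂ) * φ x‖) 2 := by
  obtain ⟨C, hC⟩ := hφ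
  refine MemLp.of_le_mul (c := |C|) hu ?_ ?_
  · exact (continuous_one_add_abs_rpow b).aestronglyMeasurable.mul
      ((Complex.continuous_ofReal.comp_aestronglyMeasurable hu.aestronglyMeasurable).mul hφm).norm
  · filter_upwards [hC] with x hx
    have hx0 : 0 < 1 + |x| := by positivity
    rw [norm_weight_mul, norm_mul, Complex.norm_real, norm_smul,
      Real.norm_of_nonneg (r := (1 + |x|) ^ s) (by positivity)]
    calc (1 + |x|) ^ b * (‖u x‖ * ‖φ x‖)
        ≤ (1 + |x|) ^ (s + a) * (‖u x‖ * (|C| * (1 + |x|) ^ (-a))) := by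
          gcongr
          · linarith [abs_nonneg x]
          · exact hx.trans (by gcongr; exact le_abs_self C)
      _ = |C| * (((1 + |x|) ^ (s + a) * (1 + |x|) ^ (-a)) * ‖u x‖) := by ring
      _ = _ := by rw [← Real.rpow_add hx0]; congr 3; ring

/-- Passing from weighted `L²` to weighted `L¹` costs more than half a power: Cauchy–Schwarz against
(1 + |x|)^{-r} needs r = s + a - b > 1/2. -/
theorem integrable_weight_potential (hu : MemWeightedLp u 2 s) (hφm : AEStronglyMeasurable φ)
    (hφ : DecayRate φ a) (hb : b + 1 / 2 < s + a) :
    Integrable (fun x : ℝ => (1 + |x|) ^ b * ‖(u x : ℂ) * φ x‖) := by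
  have h1 := memLp_weight_potential hu hφm hφ (le_refl (s + a))
  have h2 := memLp_one_add_abs_rpow (r := s + a - b) (by linarith)
  refine (h2.integrable_mul h1).congr (ae_of_all _ fun x => ?_)
  have hx0 : 0 < 1 + |x| := by positivity
  simp only [Pi.mul_apply]
  rw [← mul_assoc, ← Real.rpow_add hx0]
  congr 2
  ring

theorem memLp_potential (hu : MemWeightedLp u 2 s) (hφm : AEStronglyMeasurable φ)
    (hφ : DecayRate φ a) (h : 0 ≤ s + a) : MemLp (fun x => (u x : ℂ) * φ x) 2 := by
  have h1 := memLp_weight_potential hu hφm hφ h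
  simp only [Real.rpow_zero, one_mul] at h1
  exact (memLp_norm_iff ((Complex.continuous_ofReal.comp_aestronglyMeasurable
    hu.aestronglyMeasurable).mul hφm)).1 h1

theorem integrable_potential (hu : MemWeightedLp u 2 s) (hφm : AEStronglyMeasurable φ)
    (hφ : DecayRate φ a) (h : 1 / 2 < s + a) : Integrable (fun x => (u x : ℂ) * φ x) := by
  have h1 := integrable_weight_potential (b := 0) hu hφm hφ (by linarith)
  simp only [Real.rpow_zero, one_mul] at h1
  exact (integrable_norm_iff ((Complex.continuous_ofReal.comp_aestronglyMeasurable
    hu.aestronglyMeasurable).mul hφm)).1 h1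

end

theorem integral_norm_mul_norm_le {K : ℝ → ℂ} {g : ℝ → ℝ} (hK : MemLp K 2) (hg : MemLp g 2)
    (x : ℝ) : ∫ y, ‖K (x - y)‖ * g y ≤ (∫ y, ‖K y‖ ^ 2) + ∫ y, g y ^ 2 := by
  have hKx := memLp_comp_const_sub hK x
  have i1 : Integrable fun y => ‖K (x - y)‖ ^ 2 := (memLp_two_iff_integrable_sq_norm hKx.1).1 hKx
  have i2 : Integrable fun y => g y ^ 2 := hg.integrable_sq
  rw [← integral_sub_left_eq_self (fun y => ‖K y‖ ^ 2) volume x, ← integral_add i1 i2]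
  refine integral_mono (hKx.norm.integrable_mul hg) (i1.add i2) fun y => ?_
  nlinarith [sq_nonneg (‖K (x - y)‖ - g y), sq_nonneg (‖K (x - y)‖ + g y)]

theorem rpow_one_add_abs_le {θ : ℝ} (h0 : 0 ≤ θ) (h1 : θ ≤ 1) (x y : ℝ) :
    (1 + |x|) ^ θ ≤ (1 + |x - y|) + (1 + |y|) ^ θ := by
  have ha : 0 ≤ 1 + |x - y| := by positivity
  have hb : 0 ≤ 1 + |y| := by positivity
  have hxy : |x| ≤ |x - y| + |y| := by
    have := abs_add_le (x - y) y
    rwa [sub_add_cancel] at this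
  calc (1 + |x|) ^ θ ≤ ((1 + |x - y|) + (1 + |y|)) ^ θ := by
        exact Real.rpow_le_rpow (by positivity) (by linarith) h0
    _ ≤ (1 + |x - y|) ^ θ + (1 + |y|) ^ θ := by
        have := NNReal.rpow_add_le_add_rpow ⟨_, ha⟩ ⟨_, hb⟩ h0 h1
        exact_mod_cast this
    _ ≤ _ := by
        gcongr
        exact Real.rpow_le_self_of_one_le (by linarith [abs_nonneg (x - y)]) h1

/-- The weight at x is split between x - y and y. The part |x - y| is absorbed by the decay C/|x -
y| of the kernel, which is why θ cannot exceed 1; the other parts are products of `L²` functions. -/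
theorem exists_rpow_mul_norm_convolution_le {K f : ℝ → ℂ} {C : ℝ} (hK : MemLp K 2)
    (hKC : ∀ x, x ≠ 0 → ‖K x‖ ≤ C / |x|) (hf : Integrable f) (hf2 : MemLp f 2) {θ : ℝ}
    (h0 : 0 ≤ θ) (h1 : θ ≤ 1) (hw : MemLp (fun x : ℝ => (1 + |x|) ^ θ * ‖f x‖) 2) :
    ∃ D : ℝ, ∀ x : ℝ, (1 + |x|) ^ θ * ‖∫ y, K (x - y) * f y‖ ≤ D := by
  refine ⟨((∫ y, ‖K y‖ ^ 2) + ∫ y, ‖f y‖ ^ 2) + C * (∫ y, ‖f y‖) +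
    ((∫ y, ‖K y‖ ^ 2) + ∫ y : ℝ, ((1 + |y|) ^ θ * ‖f y‖) ^ 2), fun x => ?_⟩
  have hKx := memLp_comp_const_sub hK x
  have i1 : Integrable fun y => ‖K (x - y)‖ * ‖f y‖ := hKx.norm.integrable_mul hf2.norm
  have i2 : Integrable fun y => C * ‖f y‖ := hf.norm.const_mul C
  have i3 : Integrable fun y : ℝ => ‖K (x - y)‖ * ((1 + |y|) ^ θ * ‖f y‖) :=
    hKx.norm.integrable_mul hw
  have i12 : Integrable fun y => ‖K (x - y)‖ * ‖f y‖ + C * ‖f y‖ := i1.add i2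
  calc (1 + |x|) ^ θ * ‖∫ y, K (x - y) * f y‖
      ≤ (1 + |x|) ^ θ * ∫ y, ‖K (x - y)‖ * ‖f y‖ := by
        gcongr
        refine (norm_integral_le_integral_norm _).trans_eq ?_
        simp_rw [norm_mul]
    _ = ∫ y, (1 + |x|) ^ θ * (‖K (x - y)‖ * ‖f y‖) := (integral_const_mul _ _).symm
    _ ≤ ∫ y, (‖K (x - y)‖ * ‖f y‖ + C * ‖f y‖ + ‖K (x - y)‖ * ((1 + |y|) ^ θ * ‖f y‖)) := by
        refine integral_mono_ae (i1.const_mul _) (i12.add i3) ?_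
        have hne : ∀ᵐ y : ℝ, x - y ≠ 0 :=
          (measurePreserving_const_sub x).quasiMeasurePreserving.ae ae_ne_zero
        filter_upwards [hne] with y hy
        have h2 := hKC _ hy
        rw [le_div_iff₀ (abs_pos.2 hy)] at h2
        have h3 := rpow_one_add_abs_le h0 h1 x y
        calc (1 + |x|) ^ θ * (‖K (x - y)‖ * ‖f y‖)
            ≤ ((1 + |x - y|) + (1 + |y|) ^ θ) * (‖K (x - y)‖ * ‖f y‖) := by gcongr
          _ = ‖K (x - y)‖ * ‖f y‖ + (‖K (x - y)‖ * |x - y|) * ‖f y‖ +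
                ‖K (x - y)‖ * ((1 + |y|) ^ θ * ‖f y‖) := by ring
          _ ≤ _ := by gcongr
    _ = (∫ y, ‖K (x - y)‖ * ‖f y‖) + (∫ y, C * ‖f y‖) +
          ∫ y : ℝ, ‖K (x - y)‖ * ((1 + |y|) ^ θ * ‖f y‖) := by
        rw [integral_add i12 i3, integral_add i1 i2]
    _ ≤ _ := by
        rw [integral_const_mul]
        gcongr
        · exact integral_norm_mul_norm_le hK hf2.norm x
        · exact integral_norm_mul_norm_le hK hw x

/-! ### Vanishing of solutions on the cut -/

section

variable {u : ℝ → ℝ} {φ : ℝ → ℂ} {s s₁ l : ℝ}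

theorem isFourierPair_convolution_kernelNeg (hl : 0 < l) {f : ℝ → ℂ} (hf : Integrable f)
    (hf2 : MemLp f 2) :
    IsFourierPair (fun x => ∫ y, kernelNeg l (x - y) * f y) fun ξ => symbolNeg l ξ * 𝓕 f ξ := by
  obtain ⟨M, hM⟩ := exists_bound_of_norm_le (exists_norm_symbolNeg_le hl)
  exact isFourierPair_convolution (memLp_symbolNeg hl) hM (isFourierPair_kernelNeg hl) hf hf2

theorem conj_symbolNeg (l ξ : ℝ) : (starRingEnd ℂ) (symbolNeg l ξ) = symbolNeg l ξ := by
  rw [symbolNeg, map_div₀, conj_ofReal_mul_ofReal_sub, map_sub, map_one]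
  rcases le_or_gt ξ 0 with h | h
  · simp [chiPos_of_nonpos h]
  · simp [chiPos_of_pos h]

/-- The symbol is real, so convolution with `kernelNeg` has a real quadratic form. -/
theorem im_integral_conj_convolution_kernelNeg_mul (hl : 0 < l) {f : ℝ → ℂ} (hf : Integrable f)
    (hf2 : MemLp f 2) :
    (∫ x, (starRingEnd ℂ) (∫ y, kernelNeg l (x - y) * f y) * f x).im = 0 := by
  rw [(isFourierPair_convolution_kernelNeg hl hf hf2).integral_conj_mul
    (IsFourierPair.of_integrable hf hf2), ← Complex.conj_eq_iff_im, ← integral_conj]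
  congr with ξ
  rw [map_mul, Complex.conj_conj, map_mul, conj_symbolNeg]
  ring

/-- Multiplication by u gains s powers and the passage to `L¹` costs s₁ > 1/2, for a net gain s -
s₁; the convolution term caps the result at 1. -/
theorem decayRate_step (hl : 0 < l) (hs₁ : 1 / 2 < s₁) (hu : MemWeightedLp u 2 s)
    (hφm : AEStronglyMeasurable φ)
    (h0 : ∫ x, demodulate l (fun x => (u x : ℂ) * φ x) x = 0)
    (heq : ∀ᵐ x : ℝ, φ x = retarded l (fun x => (u x : ℂ) * φ x) x -
      ∫ y, kernelNeg l (x - y) * ((u y : ℂ) * φ y))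
    {a : ℝ} (ha : 0 ≤ a + (s - s₁)) (hφ : DecayRate φ a) :
    DecayRate φ (min 1 (a + (s - s₁))) := by
  set θ := min 1 (a + (s - s₁)) with hθ
  have hθ0 : 0 ≤ θ := le_min zero_le_one ha
  have hθ1 : θ ≤ 1 := min_le_left _ _
  have hθa : θ ≤ a + (s - s₁) := min_le_right _ _
  have hf := integrable_potential hu hφm hφ (by linarith)
  have hf2 := memLp_potential hu hφm hφ (by linarith)
  have hw := integrable_weight_potential (b := θ) hu hφm hφ (by linarith)
  obtain ⟨C, hC⟩ := exists_tendsto_kernelNeg hl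
  obtain ⟨D, hD⟩ := exists_rpow_mul_norm_convolution_le (isFourierPair_kernelNeg hl).memLp_left
    (fun x hx => (hC x hx).1) hf hf2 hθ0 hθ1 (memLp_weight_potential hu hφm hφ (by linarith))
  have hA := rpow_mul_norm_retarded_le l hf h0 hθ0 hw
  refine ⟨(∫ y : ℝ, (1 + |y|) ^ θ * ‖(u y : ℂ) * φ y‖) + D, ?_⟩
  filter_upwards [heq] with x hx
  have hx0 : 0 < 1 + |x| := by positivity
  rw [Real.rpow_neg hx0.le, ← div_eq_mul_inv, le_div_iff₀ (by positivity), hx, mul_comm]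
  calc _ ≤ (1 + |x|) ^ θ * (‖retarded l (fun x => (u x : ℂ) * φ x) x‖ +
        ‖∫ y, kernelNeg l (x - y) * ((u y : ℂ) * φ y)‖) := by
          gcongr
          exact norm_sub_le _ _
    _ ≤ _ := by
          rw [mul_add]
          exact add_le_add (hA x) (hD x)

theorem decayRate_one (hl : 0 < l) (hs₁ : 1 / 2 < s₁) (hs : s₁ < s) (hu : MemWeightedLp u 2 s)
    (hφm : AEStronglyMeasurable φ)
    (h0 : ∫ x, demodulate l (fun x => (u x : ℂ) * φ x) x = 0)
    (heq : ∀ᵐ x : ℝ, φ x = retarded l (fun x => (u x : ℂ) * φ x) x -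
      ∫ y, kernelNeg l (x - y) * ((u y : ℂ) * φ y))
    (hφ : DecayRate φ (-(s - s₁))) : DecayRate φ 1 := by
  have hδ : 0 < s - s₁ := sub_pos.2 hs
  -- The induction starts at the given rate -(s - s₁), so the first application of `decayRate_step`
  -- lands at exponent 0, the edge of its hypothesis `ha`.
  have key : ∀ n : ℕ, DecayRate φ (min 1 ((n : ℝ) * (s - s₁) - (s - s₁))) := by
    intro n
    induction n with
    | zero =>
      rwa [Nat.cast_zero, zero_mul, zero_sub, min_eq_right (by linarith)]
    | succ n ih =>
      have hn : 0 ≤ (n : ℝ) * (s - s₁) := by positivity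
      have h1 := decayRate_step hl hs₁ hu hφm h0 heq (by
        rw [← sub_le_iff_le_add, zero_sub]
        exact le_min (by linarith) (by linarith)) ih
      convert h1 using 1
      push_cast
      rw [← min_add_add_right, ← min_assoc, min_eq_left (show (1 : ℝ) ≤ 1 + (s - s₁) by linarith)]
      congr 1
      ring
  obtain ⟨n, hn⟩ := exists_nat_ge ((1 + (s - s₁)) / (s - s₁))
  rw [div_le_iff₀ hδ] at hn
  have := key n
  rwa [min_eq_left (by linarith)] at this

theorem ae_eq_zero_of_retarded_eq (hl : 0 < l) (hs₁ : 1 / 2 < s₁) (hs : s₁ < s)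
    (hu : MemWeightedLp u 2 s) (hφm : AEStronglyMeasurable φ)
    (h0 : ∫ x, demodulate l (fun x => (u x : ℂ) * φ x) x = 0)
    (heq : ∀ᵐ x : ℝ, φ x = retarded l (fun x => (u x : ℂ) * φ x) x -
      ∫ y, kernelNeg l (x - y) * ((u y : ℂ) * φ y))
    (hφ : DecayRate φ (-(s - s₁))) : φ =ᵐ[volume] 0 := by
  have h1 := decayRate_one hl hs₁ hs hu hφm h0 heq hφ
  have hf := integrable_potential hu hφm h1 (by linarith)
  have hf2 := memLp_potential hu hφm h1 (by linarith)
  -- The retarded part is not capped by the kernel: rate 1 for φ gives it rate 1 + (s - s₁), since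
  -- s₁ > 1/2. This exceeds 1, so the retarded integral is in L¹ as well as L².
  have hA : ∀ x : ℝ, ‖retarded l (fun x => (u x : ℂ) * φ x) x‖ ≤
      (∫ y : ℝ, (1 + |y|) ^ (1 + (s - s₁)) * ‖(u y : ℂ) * φ y‖) *
        ‖(1 + |x|) ^ (-(1 + (s - s₁)))‖ := by
    intro x
    have hx0 : 0 < 1 + |x| := by positivity
    rw [Real.norm_of_nonneg (by positivity), Real.rpow_neg hx0.le, ← div_eq_mul_inv,
      le_div_iff₀ (by positivity), mul_comm]
    exact rpow_mul_norm_retarded_le l hf h0 (by linarith)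
      (integrable_weight_potential hu hφm h1 (by linarith)) x
  have hAm := (continuous_retarded l hf).aestronglyMeasurable (μ := volume)
  have hA1 : Integrable (retarded l fun x => (u x : ℂ) * φ x) :=
    (memLp_one_iff_integrable).1 (MemLp.of_le_mul
      (memLp_one_iff_integrable.2 (integrable_one_add_abs_rpow (by linarith))) hAm
      (ae_of_all _ hA))
  have hA2 : MemLp (retarded l fun x => (u x : ℂ) * φ x) 2 :=
    MemLp.of_le_mul (memLp_one_add_abs_rpow (by linarith)) hAm (ae_of_all _ hA)
  have hp := ((IsFourierPair.of_integrable hA1 hA2).sub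
    (isFourierPair_convolution_kernelNeg hl hf hf2)).congr
      (φ' := φ) (heq.mono fun x hx => hx.symm) EventuallyEq.rfl
  refine ae_eq_zero_of_norm_integral_sq_eq (u := u) hl hp.memLp_left
    (norm_integral_sq_eq hl.ne' hf hf2 hp ?_)
  filter_upwards [ae_two_pi_mul_ne (l : ℂ)] with ξ hξ
  rw [mul_sub, fourier_retarded l hf hA1 hξ, symbolNeg]
  field_simp
  ring

/-- Covers both sides of the cut: c = 0 above, c = ∫ e^{-iλy} f below. With f = uφ the left side is
0, while the right side is -|∫ e^{-iλy} f|²/2 above and +|∫ e^{-iλy} f|²/2 below, so this mean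
vanishes in either case. -/
theorem integral_conj_sub_mul_im (hl : 0 < l) {f φ : ℝ → ℂ} (hf : Integrable f)
    (hf2 : MemLp f 2) (c : ℂ)
    (heq : ∀ᵐ x : ℝ, φ x = retarded l f x - Complex.I * Complex.exp (Complex.I * l * x) * c -
      ∫ y, kernelNeg l (x - y) * f y) :
    (∫ x, (starRingEnd ℂ) (φ x) * f x).im = -‖∫ x, demodulate l f x‖ ^ 2 / 2 +
      ((starRingEnd ℂ) c * ∫ x, demodulate l f x).re := by
  have hB := (isFourierPair_convolution_kernelNeg hl hf hf2).memLp_left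
  have i1 : Integrable fun x => (starRingEnd ℂ) (retarded l f x) * f x := by
    refine hf.bdd_mul (c := ∫ y, ‖f y‖)
      (Complex.continuous_conj.comp (continuous_retarded l hf)).aestronglyMeasurable
      (ae_of_all _ fun x => ?_)
    rw [RCLike.norm_conj]
    exact norm_retarded_le l hf x
  have i2 : Integrable fun x => Complex.I * (starRingEnd ℂ) c * demodulate l f x :=
    (integrable_demodulate l hf).const_mul _
  have i3 : Integrable fun x => (starRingEnd ℂ) (∫ y, kernelNeg l (x - y) * f y) * f x :=
    integrable_mul_of_memLp_two hB.star hf2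
  have h1 : ∫ x, (starRingEnd ℂ) (φ x) * f x =
      ∫ x, ((starRingEnd ℂ) (retarded l f x) * f x +
        Complex.I * (starRingEnd ℂ) c * demodulate l f x -
        (starRingEnd ℂ) (∫ y, kernelNeg l (x - y) * f y) * f x) := by
    refine integral_congr_ae ?_
    filter_upwards [heq] with x hx
    have he : (starRingEnd ℂ) (Complex.exp (Complex.I * l * x)) =
        Complex.exp (-(Complex.I * l * x)) := by
      rw [← Complex.exp_conj, map_mul, map_mul, Complex.conj_I, Complex.conj_ofReal,
        Complex.conj_ofReal]
      congr 1
      ring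
    rw [hx, map_sub, map_sub, map_mul, map_mul, Complex.conj_I, he, demodulate]
    ring
  have h2 := integral_conj_retarded_mul_im l hf
  have h3 := im_integral_conj_convolution_kernelNeg_mul hl hf hf2
  have i12 : Integrable fun x => (starRingEnd ℂ) (retarded l f x) * f x +
      Complex.I * (starRingEnd ℂ) c * demodulate l f x := i1.add i2
  rw [h1, integral_sub i12 i3, integral_add i1 i2, integral_const_mul, Complex.sub_im,
    Complex.add_im, h3, mul_assoc, Complex.I_mul_im]
  linarith

theorem integrable_retarded_kernel_mul {f : ℝ → ℂ} (hf : Integrable f) {S : Set ℝ}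
    (hS : MeasurableSet S) (c : ℂ) (x : ℝ) :
    Integrable fun y => S.indicator
      (fun z : ℝ => c * Complex.exp (Complex.I * (l : ℂ) * (z : ℂ))) (x - y) * f y := by
  refine hf.bdd_mul (c := ‖c‖) ?_ (ae_of_all _ fun y => ?_)
  · have hc : Continuous fun z : ℝ => c * Complex.exp (Complex.I * (l : ℂ) * (z : ℂ)) := by
      fun_prop
    exact ((hc.measurable.indicator hS).comp (measurable_const.sub measurable_id)
      ).aestronglyMeasurable
  · refine (norm_indicator_le_norm_self _ _).trans_eq ?_
    rw [norm_mul, norm_exp_I_mul, mul_one]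

theorem integral_indicator_exp_mul (f : ℝ → ℂ) {S : Set ℝ} (hS : MeasurableSet S) (c : ℂ)
    (x : ℝ) : ∫ y, S.indicator
      (fun z : ℝ => c * Complex.exp (Complex.I * (l : ℂ) * (z : ℂ))) (x - y) * f y =
      c * Complex.exp (Complex.I * l * x) * ∫ y in (fun y => x - y) ⁻¹' S, demodulate l f y := by
  have hS' : MeasurableSet ((fun y => x - y) ⁻¹' S) :=
    (measurable_const.sub measurable_id : Measurable fun y : ℝ => x - y) hS
  rw [← integral_const_mul, ← integral_indicator hS']
  congr with y
  by_cases hy : x - y ∈ S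
  · rw [Set.indicator_of_mem hy, Set.indicator_of_mem (show y ∈ (fun y => x - y) ⁻¹' S from hy),
      demodulate]
    have : Complex.exp (Complex.I * l * (x - y : ℝ)) =
        Complex.exp (Complex.I * l * x) * Complex.exp (-(Complex.I * l * y)) := by
      rw [← Complex.exp_add]
      congr 1
      push_cast
      ring
    rw [this]
    ring
  · rw [Set.indicator_of_notMem hy,
      Set.indicator_of_notMem (show y ∉ (fun y => x - y) ⁻¹' S from hy), zero_mul]

theorem opT_above (hl : 0 < l) (hf : Integrable fun x => (u x : ℂ) * φ x)
    (hf2 : MemLp (fun x => (u x : ℂ) * φ x) 2) (x : ℝ) :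
    opT u (.above l hl) φ x = retarded l (fun x => (u x : ℂ) * φ x) x -
      ∫ y, kernelNeg l (x - y) * ((u y : ℂ) * φ y) := by
  have i1 := integrable_retarded_kernel_mul (l := l) hf measurableSet_Ioi Complex.I x
    (S := Set.Ioi 0)
  have i2 : Integrable fun y => kernelNeg l (x - y) * ((u y : ℂ) * φ y) :=
    integrable_mul_of_memLp_two (memLp_comp_const_sub (isFourierPair_kernelNeg hl).memLp_left x) hf2
  have e := integral_indicator_exp_mul (l := l) (fun x => (u x : ℂ) * φ x) measurableSet_Ioi
    Complex.I x (S := Set.Ioi 0)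
  have hS : (fun y => x - y) ⁻¹' Set.Ioi 0 = Set.Iio x := by ext; simp
  rw [hS] at e
  rw [retarded, ← e, ← integral_sub i1 i2]
  simp only [opT, kernelG, sub_mul]

/-- The advanced integral -i∫_{(x,∞)} is the retarded one minus i times the integral over the whole
line, so both sides of the cut are treated with `retarded`. -/
theorem opT_below (hl : 0 < l) (hf : Integrable fun x => (u x : ℂ) * φ x)
    (hf2 : MemLp (fun x => (u x : ℂ) * φ x) 2) (x : ℝ) :
    opT u (.below l hl) φ x = retarded l (fun x => (u x : ℂ) * φ x) x -
      Complex.I * Complex.exp (Complex.I * l * x) *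
        (∫ y, demodulate l (fun x => (u x : ℂ) * φ x) y) -
      ∫ y, kernelNeg l (x - y) * ((u y : ℂ) * φ y) := by
  have i1 := integrable_retarded_kernel_mul (l := l) hf measurableSet_Iio (-Complex.I) x
    (S := Set.Iio 0)
  have i2 : Integrable fun y => kernelNeg l (x - y) * ((u y : ℂ) * φ y) :=
    integrable_mul_of_memLp_two (memLp_comp_const_sub (isFourierPair_kernelNeg hl).memLp_left x) hf2
  have e := integral_indicator_exp_mul (l := l) (fun x => (u x : ℂ) * φ x) measurableSet_Iio
    (-Complex.I) x (S := Set.Iio 0)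
  have hS : (fun y => x - y) ⁻¹' Set.Iio 0 = Set.Ioi x := by ext; simp
  rw [hS, integral_Ioi_eq_sub (integrable_demodulate l hf)] at e
  have e2 : retarded l (fun x => (u x : ℂ) * φ x) x -
      Complex.I * Complex.exp (Complex.I * l * x) *
        (∫ y, demodulate l (fun x => (u x : ℂ) * φ x) y) =
      -Complex.I * Complex.exp (Complex.I * l * x) *
        ((∫ y, demodulate l (fun x => (u x : ℂ) * φ x) y) -
          ∫ y in Set.Iio x, demodulate l (fun x => (u x : ℂ) * φ x) y) := by
    rw [retarded]
    ring
  rw [e2, ← e, ← integral_sub i1 i2]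
  simp only [opT, kernelG, sub_mul, neg_mul]

theorem ae_eq_zero_of_eq_opT_cut (hs₁ : 1 / 2 < s₁) (hs : s₁ < s)
    (hu : MemWeightedLp u 2 s) (hφ : MemWeightedLp φ ⊤ (-(s - s₁))) (hl : 0 < l)
    (h : φ =ᵐ[volume] opT u (.above l hl) φ ∨ φ =ᵐ[volume] opT u (.below l hl) φ) :
    φ =ᵐ[volume] 0 := by
  have hφm := hφ.aestronglyMeasurable
  have hf := integrable_potential hu hφm hφ.decayRate (by linarith)
  have hf2 := memLp_potential hu hφm hφ.decayRate (by linarith)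
  have him := im_integral_conj_mul_potential φ u
  rcases h with h | h
  · have heq : ∀ᵐ x : ℝ, φ x = retarded l (fun x => (u x : ℂ) * φ x) x -
        ∫ y, kernelNeg l (x - y) * ((u y : ℂ) * φ y) := by
      filter_upwards [h] with x hx
      rw [← opT_above hl hf hf2]
      exact hx
    have h1 := integral_conj_sub_mul_im hl hf hf2 0 (by simpa using heq)
    rw [him, map_zero, zero_mul, Complex.zero_re] at h1
    have h0 : ∫ x, demodulate l (fun x => (u x : ℂ) * φ x) x = 0 := by
      rw [← norm_eq_zero, ← sq_eq_zero_iff]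
      linarith
    exact ae_eq_zero_of_retarded_eq hl hs₁ hs hu hφm h0 heq hφ.decayRate
  · have heq := h.trans (ae_of_all _ (opT_below hl hf hf2))
    have h1 := integral_conj_sub_mul_im hl hf hf2 _ heq
    rw [him, mul_comm, Complex.mul_conj, Complex.ofReal_re, Complex.normSq_eq_norm_sq] at h1
    have h0 : ∫ x, demodulate l (fun x => (u x : ℂ) * φ x) x = 0 := by
      rw [← norm_eq_zero, ← sq_eq_zero_iff]
      linarith
    refine ae_eq_zero_of_retarded_eq hl hs₁ hs hu hφm h0 ?_ hφ.decayRate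
    filter_upwards [heq] with x hx
    rw [hx, h0, mul_zero, sub_zero]

end

end BenjaminOno

/-! ### Assembly of the theorem -/

theorem BenjaminOno.MemWeightedLp.memLp_two {u : ℝ → ℝ} {s : ℝ} (hs : 0 ≤ s)
    (hu : BenjaminOno.MemWeightedLp u 2 s) : MemLp u 2 := by
  refine MemLp.of_le hu hu.aestronglyMeasurable (ae_of_all _ fun x => ?_)
  have h1 : 1 ≤ (1 + |x|) ^ s := Real.one_le_rpow (by linarith [abs_nonneg x]) hs
  rw [norm_smul]
  exact le_mul_of_one_le_left (norm_nonneg _) (h1.trans (le_abs_self _))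

theorem lemma3p4 (s s₁ : ℝ) (hs₁ : 1 / 2 < s₁) (hs : s₁ < s)
    (u : ℝ → ℝ) (hu : BenjaminOno.MemWeightedLp u 2 s) :
    (∀ (k : BenjaminOno.CutPlane) (φ : ℝ → ℂ),
      BenjaminOno.MemWeightedLp φ ⊤ (-(s - s₁)) →
      φ =ᵐ[volume] BenjaminOno.opT u k φ →
        (k.val.im ≠ 0 → φ =ᵐ[volume] 0) ∧
        (k.val.im = 0 →
          Integrable (fun x => (u x : ℂ) * φ x) volume ∧ MemLp φ 2 volume ∧
          ‖∫ x : ℝ, (u x : ℂ) * φ x‖ ^ 2 = -2 * Real.pi * k.val.re * ∫ x : ℝ, ‖φ x‖ ^ 2) ∧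
        ((∃ (l : ℝ) (hl : 0 < l),
            k = BenjaminOno.CutPlane.above l hl ∨ k = BenjaminOno.CutPlane.below l hl) →
          φ =ᵐ[volume] 0) ∧
        (k.val ∈ BenjaminOno.resolventSet (BenjaminOno.opL u) → φ =ᵐ[volume] 0)) ∧
    (∀ l : ℝ, 0 < l → ¬ BenjaminOno.IsEigenvalue (BenjaminOno.opL u) (l : ℂ)) := by
  open BenjaminOno in
  refine ⟨fun k φ hφ h => ?_, fun l hl => not_isEigenvalue_opL (hu.memLp_two (by linarith)) hl⟩
  have hφm := hφ.aestronglyMeasurable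
  -- For a = -(s - s₁) the sum s + a equals s₁, which exceeds 1/2.
  have hf := integrable_potential hu hφm hφ.decayRate (by linarith)
  have hf2 := memLp_potential hu hφm hφ.decayRate (by linarith)
  have cut : ∀ (l : ℝ) (hl : 0 < l), k = .above l hl ∨ k = .below l hl → φ =ᵐ[volume] 0 := by
    rintro l hl (rfl | rfl)
    · exact ae_eq_zero_of_eq_opT_cut hs₁ hs hu hφ hl (Or.inl h)
    · exact ae_eq_zero_of_eq_opT_cut hs₁ hs hu hφ hl (Or.inr h)
  have zero : φ =ᵐ[volume] 0 → Integrable (fun x => (u x : ℂ) * φ x) volume ∧ MemLp φ 2 volume ∧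
      ‖∫ x : ℝ, (u x : ℂ) * φ x‖ ^ 2 =
        -2 * Real.pi * k.val.re * ∫ x : ℝ, ‖φ x‖ ^ 2 := by
    intro h0
    refine ⟨hf, (MemLp.zero (p := 2) (μ := volume) (ε := ℂ)).ae_eq h0.symm, ?_⟩
    have e1 : ∫ x : ℝ, (u x : ℂ) * φ x = 0 :=
      integral_eq_zero_of_ae (h0.mono fun x hx => by simp [hx])
    have e2 : ∫ x : ℝ, ‖φ x‖ ^ 2 = 0 :=
      integral_eq_zero_of_ae (h0.mono fun x hx => by simp [hx])
    simp [e1, e2]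
  cases k with
  | above l hl =>
    have h0 := cut l hl (Or.inl rfl)
    exact ⟨fun _ => h0, fun _ => zero h0, fun _ => h0, fun _ => h0⟩
  | below l hl =>
    have h0 := cut l hl (Or.inr rfl)
    exact ⟨fun _ => h0, fun _ => zero h0, fun _ => h0, fun _ => h0⟩
  | off k hk =>
    have hp := isFourierPair_of_eq_opT_off hk hf hf2 h
    have hψ := two_pi_mul_sub_mul_symbolPos (k := k) (𝓕 fun x => (u x : ℂ) * φ x)
    refine ⟨fun him => ae_eq_zero_of_im_ne_zero him hf hf2 hp, fun him => ⟨hf, hp.memLp_left, ?_⟩,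
      fun ⟨l, hl, hlk⟩ => cut l hl hlk,
      fun hres => ae_eq_zero_of_mem_resolventSet hres hf hf2 hp hψ⟩
    have hkr : (k.re : ℂ) = k := Complex.ext rfl (Eq.symm him)
    -- The removed ray contains 0; only k ≠ 0 is needed for the trace identity, not the sign of k.
    have hk0 : k.re ≠ 0 := fun h0 => hk ⟨0, Set.self_mem_Ici, by rw [← hkr, h0]⟩
    refine norm_integral_sq_eq hk0 hf hf2 hp ?_
    change ∀ᵐ ξ : ℝ, (2 * Real.pi * ξ - (k.re : ℂ)) * _ = _
    rw [hkr]
    exact hψ
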